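/- Let $\theta\in(0,\pi/2)$ and $P\ge 0$. The equation $$x^2-\sin^2\theta=\Big(\max\Big(0,\frac{\cos\theta}{1+x^2P}-x\Big)\Big)^2$$ has exactly one positive solution $x=h_0(\theta,P)$. Let $d,c\in\mathbb R^m$ be unit vectors with angle $\theta$ between them, let $h\in\mathbb R$ satisfy $|h|<h_0(\theta,P)$, and consider the symmetric two-user MISO Gaussian interference channel $$Y_1=d^\top X_1+h\,c^\top X_2+Z_1,\qquad Y_2=d^\top X_2+h\,c^\top X_1+Z_2,$$ where transmitter $i$ sends $X_i\in\mathbb R^m$, receiver $i$ observes $Y_i$, the noises $Z_1,Z_2\sim\mathcal N(0,1)$ are i.i.d. in time, and the input of each user over a block of length $n$ satisfies the average power constraint $\frac1n\sum_{t=1}^n\mathbb E\|X_{it}\|^2\le P$. Let the sum capacity be the supremum of $R_1+R_2$ over all rate pairs (in nats per channel use) achievable with vanishing average error probability. For positive semidefinite $Q_1,Q_2$ of trace at most $P$, let $$R_{\mathrm{TIN}}(Q_1,Q_2)=I(X_1;Y_1)+I(X_2;Y_2)$$ for independent inputs $X_i\sim\mathcal N(0,Q_i)$, independent of the noise; this is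 the sum rate of Gaussian inputs with covariances $Q_1,Q_2$ when each receiver treats interference as noise (TIN). Put $$b=\frac{(I+h^2P\,cc^\top)^{-1}d}{\|(I+h^2P\,cc^\top)^{-1}d\|},\qquad Q^*=P\,bb^\top .$$ Then $Q^*$ satisfies the power constraint, and the sum capacity is achieved by Gaussian inputs with transmit beamforming along $b$ and treating interference as noise: $$\mathcal C_{\mathrm{sum}}=R_{\mathrm{TIN}}(Q^*,Q^*)=\log\Big(1+\frac{P\cos^2\theta}{1+h^2P}+P\sin^2\theta\Big),$$ where $\log$ is the natural logarithm. -/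

import Mathlib

open MeasureTheory ProbabilityTheory Filter
open scoped ENNReal

namespace MISO

noncomputable section

/-- The mutual information `I(X; Y)` (in nats): the Kullback-Leibler divergence of the joint law
from the product of the marginal laws. -/
def mutualInfo {Ω α β : Type*} [MeasurableSpace Ω] [MeasurableSpace α] [MeasurableSpace β]
    (μ : Measure Ω) (X : Ω → α) (Y : Ω → β) : ℝ≥0∞ :=
  InformationTheory.klDiv (μ.map fun ω => (X ω, Y ω)) ((μ.map X).prod (μ.map Y))

/-- A received symbol of the symmetric two-user MISO Gaussian interference channel:
`dᵀ x + h cᵀ x' + z`, where `x` is sent by the user's own transmitter, `x'` by the interfering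
transmitter, and `z` is the receiver noise. -/
def received {m : ℕ} (d c : EuclideanSpace ℝ (Fin m)) (h : ℝ)
    (x x' : EuclideanSpace ℝ (Fin m)) (z : ℝ) : ℝ :=
  inner ℝ d x + h * inner ℝ c x' + z

/-- The input covariance matrices that meet the transmit power constraint `P`. -/
def covarianceConstraint (m : ℕ) (P : ℝ) : Set (Matrix (Fin m) (Fin m) ℝ) :=
  {Q | Q.PosSemidef ∧ Q.trace ≤ P}

/-- A pair of block codes of length `n` for the two users with `m` transmit antennas each:
user `i` has `Mᵢ` messages, an encoder, and a decoder that sees the output of receiver `i` only. -/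
structure Code (m n M₁ M₂ : ℕ) where
  enc₁ : Fin M₁ → Fin n → EuclideanSpace ℝ (Fin m)
  enc₂ : Fin M₂ → Fin n → EuclideanSpace ℝ (Fin m)
  dec₁ : (Fin n → ℝ) → Fin M₁
  dec₂ : (Fin n → ℝ) → Fin M₂
  measurable_dec₁ : Measurable dec₁
  measurable_dec₂ : Measurable dec₂

/-- The time-averaged second moment matrix `(1/n) ∑ₜ E[Xₜ Xₜᵀ]` of the channel inputs produced by
an encoder whose message is uniformly distributed. -/
def inputCovariance {m n M : ℕ} (enc : Fin M → Fin n → EuclideanSpace ℝ (Fin m)) :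
    Matrix (Fin m) (Fin m) ℝ :=
  (n : ℝ)⁻¹ • ∑ t, (M : ℝ)⁻¹ • ∑ w, Matrix.vecMulVec (enc w t) (enc w t)

/-- The law of `n` i.i.d. standard Gaussian noise samples. -/
def noise (n : ℕ) : Measure (Fin n → ℝ) :=
  Measure.pi fun _ => gaussianReal 0 1

/-- The error probability at receiver 1, for independent uniformly distributed messages. -/
def Code.errorProb₁ {m n M₁ M₂ : ℕ} (C : Code m n M₁ M₂)
    (d c : EuclideanSpace ℝ (Fin m)) (h : ℝ) : ℝ :=
  ((M₁ : ℝ) * M₂)⁻¹ * ∑ w₁, ∑ w₂, (noise n).real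
    {z | C.dec₁ (fun t => received d c h (C.enc₁ w₁ t) (C.enc₂ w₂ t) (z t)) ≠ w₁}

/-- The error probability at receiver 2, for independent uniformly distributed messages. -/
def Code.errorProb₂ {m n M₁ M₂ : ℕ} (C : Code m n M₁ M₂)
    (d c : EuclideanSpace ℝ (Fin m)) (h : ℝ) : ℝ :=
  ((M₁ : ℝ) * M₂)⁻¹ * ∑ w₁, ∑ w₂, (noise n).real
    {z | C.dec₂ (fun t => received d c h (C.enc₂ w₂ t) (C.enc₁ w₁ t) (z t)) ≠ w₂}

/-- The rate pair `(R₁, R₂)` (in nats per channel use) is achievable under the average transmit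
power constraint `P` for each user. -/
def Achievable {m : ℕ} (d c : EuclideanSpace ℝ (Fin m)) (h P R₁ R₂ : ℝ) : Prop :=
  0 ≤ R₁ ∧ 0 ≤ R₂ ∧ ∀ ε > 0, ∀ᶠ n : ℕ in atTop, ∃ (M₁ M₂ : ℕ) (C : Code m n M₁ M₂),
    Real.exp (n * R₁) ≤ M₁ ∧ Real.exp (n * R₂) ≤ M₂ ∧
    inputCovariance C.enc₁ ∈ covarianceConstraint m P ∧
    inputCovariance C.enc₂ ∈ covarianceConstraint m P ∧
    C.errorProb₁ d c h ≤ ε ∧ C.errorProb₂ d c h ≤ ε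

/-- `S` is the sum capacity of the channel: the supremum of `R₁ + R₂` over all achievable rate
pairs. -/
def IsSumCapacity {m : ℕ} (d c : EuclideanSpace ℝ (Fin m)) (h P S : ℝ) : Prop :=
  IsLUB {r : ℝ | ∃ R₁ R₂ : ℝ, Achievable d c h P R₁ R₂ ∧ r = R₁ + R₂} S

/-- The mutual information `I(X; Y)` between the input `X` of a user and its received symbol `Y`,
for independent Gaussian inputs with covariance matrices `Q` (own transmitter) and `Q'`
(interfering transmitter). -/
def gaussianInputRate {m : ℕ} (d c : EuclideanSpace ℝ (Fin m)) (h : ℝ)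
    (Q Q' : Matrix (Fin m) (Fin m) ℝ) : ℝ≥0∞ :=
  mutualInfo
    ((multivariateGaussian 0 Q).prod ((multivariateGaussian 0 Q').prod (gaussianReal 0 1)))
    (fun ω => ω.1) (fun ω => received d c h ω.1 ω.2.1 ω.2.2)

/-- The sum rate `I(X₁; Y₁) + I(X₂; Y₂)` achieved by Gaussian inputs with covariance matrices
`Q₁`, `Q₂` when the receivers treat interference as noise. -/
def tinSumRate {m : ℕ} (d c : EuclideanSpace ℝ (Fin m)) (h : ℝ)
    (Q₁ Q₂ : Matrix (Fin m) (Fin m) ℝ) : ℝ≥0∞ :=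
  gaussianInputRate d c h Q₁ Q₂ + gaussianInputRate d c h Q₂ Q₁

/-- The vector `(I + h² P c cᵀ)⁻¹ d`. -/
def beamDirection {m : ℕ} (d c : EuclideanSpace ℝ (Fin m)) (h P : ℝ) :
    EuclideanSpace ℝ (Fin m) :=
  WithLp.toLp 2
    (Matrix.mulVec (1 + (h ^ 2 * P) • Matrix.vecMulVec c c : Matrix (Fin m) (Fin m) ℝ)⁻¹ d)

/-- The unit norm transmit beamforming vector. -/
def beam {m : ℕ} (d c : EuclideanSpace ℝ (Fin m)) (h P : ℝ) : EuclideanSpace ℝ (Fin m) :=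
  ‖beamDirection d c h P‖⁻¹ • beamDirection d c h P

/-- The covariance matrix `P b bᵀ` of transmit beamforming along `b` with power `P`. -/
def beamCovariance {m : ℕ} (b : EuclideanSpace ℝ (Fin m)) (P : ℝ) : Matrix (Fin m) (Fin m) ℝ :=
  P • Matrix.vecMulVec b b

/-- `x` is a positive solution of `x² - sin² θ = (max(0, cos θ / (1 + x² P) - x))²`. -/
def IsThreshold (θ P x : ℝ) : Prop :=
  0 < x ∧ x ^ 2 - Real.sin θ ^ 2 = max 0 (Real.cos θ / (1 + x ^ 2 * P) - x) ^ 2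

end

end MISO

/-!
# Sum capacity of the symmetric MISO interference channel with weak interference

The left side of the threshold equation increases in `x` and the right side decreases, which gives
the unique threshold `h₀` and a strict inequality below it (`existsUnique_isThreshold`).

*Converse.* Receiver `i` is given, as side information from a genie, `Sᵢ = h cᵀ Xᵢ + g Uᵢ`, where
the receiver noise is `p Uᵢ + g Vᵢ` with `p² + g² = 1` and `Uᵢ`, `Vᵢ` independent standard Gaussian.
Given its own message and the side information, receiver `1` sees `h cᵀ X₂ + g V₁`, which has the
same law as `S₂`, so the unknown entropies of the interference cancel in the sum of the bounds for
both users. What remains is the entropy of `Yᵢ` given `Sᵢ`, at most that of a Gaussian with the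
variance of `Yᵢ - l Sᵢ`. This variance is a quadratic form in the inputs, with largest eigenvalue
`t` attained along the beam. The inequality `|h| < h₀` is what makes parameters `g`, `p`, `l`
possible for which the side information is redundant at the beamformed Gaussian input and the beam
belongs to the largest eigenvalue (`exists_genie_parameters`, `quadratic_form_le`). The bound then
equals the claimed value (`log_card_add_log_card_le`, `add_le_of_achievable`).

No entropies of general laws are needed. With deterministic codes all densities are explicit finite
mixtures of Gaussians. Fano's inequality and the Gaussian entropy bound are both replaced by one
application of `x + 1 ≤ exp x` to the log-ratio of an auxiliary density and the true one
(`sum_integral_genieExponent_nonpos`, `genie_bound`): the auxiliary density of `(Y, S)` is the true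
density of `S` times a Gaussian density of `Y` around `l S`, tilted by the event of correct
decoding.

*Achievability.* Both users draw codebooks of i.i.d. Gaussian symbols of power slightly below `P`,
sent along the beam, and decode with a likelihood ratio test that takes interference as Gaussian
noise. Averaged over the codebooks, the interference really is Gaussian noise
(`measurePreserving_interference_add_noise`), so the sent codeword passes the test by Chebyshev's
inequality, and others pass with exponentially small probability (`measure_compl_testSet_le`,
`measure_testSet_le`, `exists_codebooks`).

*Treating interference as noise.* The mutual information of Gaussian inputs is computed from the
explicit density of the joint law with respect to the product law (`klDiv_signal_plus_noise`).
-/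

open scoped NNReal

namespace MISO

noncomputable section

/-! ### Gaussian vectors -/

/-- The law of a vector of i.i.d. centred Gaussian samples of variance `v`, indexed by `ι`. -/
def gaussPi (ι : Type*) [Fintype ι] (v : ℝ≥0) : Measure (ι → ℝ) :=
  Measure.pi fun _ => gaussianReal 0 v

/-- The Lebesgue density of `gaussPi ι v` for `v ≠ 0`. -/
def gaussDensity {ι : Type*} [Fintype ι] (v : ℝ≥0) (x : ι → ℝ) : ℝ :=
  ∏ i, gaussianPDFReal 0 v (x i)

section

variable {ι : Type*} [Fintype ι]

instance (v : ℝ≥0) : IsProbabilityMeasure (gaussPi ι v) := by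
  unfold gaussPi; infer_instance

lemma gaussDensity_pos {v : ℝ≥0} (hv : v ≠ 0) (x : ι → ℝ) : 0 < gaussDensity v x :=
  Finset.prod_pos fun _ _ => gaussianPDFReal_pos _ _ _ hv

lemma measurable_gaussDensity (v : ℝ≥0) : Measurable (gaussDensity (ι := ι) v) :=
  Finset.measurable_prod _ fun i _ =>
    (measurable_gaussianPDFReal 0 v).comp (measurable_pi_apply i)

lemma gaussDensity_le (v : ℝ≥0) (x : ι → ℝ) :
    gaussDensity v x ≤ (Real.sqrt (2 * Real.pi * v))⁻¹ ^ Fintype.card ι := by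
  unfold gaussDensity
  refine (Finset.prod_le_prod (fun i _ => gaussianPDFReal_nonneg _ _ _)
    (g := fun _ => (Real.sqrt (2 * Real.pi * v))⁻¹) fun i _ => ?_).trans_eq (by simp)
  rw [gaussianPDFReal]
  refine mul_le_of_le_one_right (by positivity) (Real.exp_le_one_iff.2 ?_)
  rw [neg_div, neg_nonpos]
  positivity

lemma log_gaussDensity {v : ℝ≥0} (hv : v ≠ 0) (x : ι → ℝ) :
    Real.log (gaussDensity v x) =
      -(Fintype.card ι / 2 * Real.log (2 * Real.pi * v)) - (∑ i, x i ^ 2) / (2 * v) := by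
  have hv' : (0 : ℝ) < v := by positivity
  have h : ∀ y : ℝ, Real.log (gaussianPDFReal 0 v y) =
      -(1 / 2 * Real.log (2 * Real.pi * v)) - y ^ 2 / (2 * v) := by
    intro y
    rw [gaussianPDFReal, Real.log_mul (by positivity) (by positivity), Real.log_exp,
      Real.log_inv, Real.log_sqrt (by positivity)]
    ring
  unfold gaussDensity
  rw [Real.log_prod fun i _ => (gaussianPDFReal_pos _ _ _ hv).ne']
  simp_rw [h, Finset.sum_sub_distrib, Finset.sum_div]
  simp
  ring

lemma gaussPi_eq_withDensity {v : ℝ≥0} (hv : v ≠ 0) :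
    gaussPi ι v = volume.withDensity fun x => ENNReal.ofReal (gaussDensity v x) := by
  refine Measure.pi_eq fun s hs => ?_
  have hint : ∀ i, Integrable (fun x => gaussianPDFReal 0 v x) (volume.restrict (s i)) :=
    fun i => (integrable_gaussianPDFReal 0 v).restrict
  rw [withDensity_apply _ (MeasurableSet.univ_pi hs), volume_pi, Measure.restrict_pi_pi]
  unfold gaussDensity
  rw [← ofReal_integral_eq_lintegral_ofReal, integral_fintype_prod_eq_prod,
    ENNReal.ofReal_prod_of_nonneg]
  · refine Finset.prod_congr rfl fun i _ => ?_
    rw [gaussianReal_apply_eq_integral _ hv]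
  · exact fun i _ => integral_nonneg fun _ => gaussianPDFReal_nonneg _ _ _
  · exact Integrable.fintype_prod_dep hint
  · exact ae_of_all _ fun x => Finset.prod_nonneg fun i _ => gaussianPDFReal_nonneg _ _ _

lemma map_linear_prod_gaussianReal (r : ℝ) (v₁ v₂ v : ℝ≥0) (hv : (v : ℝ) = r ^ 2 * v₁ + v₂) :
    ((gaussianReal 0 v₁).prod (gaussianReal 0 v₂)).map (fun p : ℝ × ℝ => r * p.1 + p.2) =
      gaussianReal 0 v := by
  have hind := indepFun_prod (μ := gaussianReal 0 v₁) (ν := gaussianReal 0 v₂)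
    (X := fun x => r * x) (Y := fun x => x) (by fun_prop) (by fun_prop)
  have := gaussianReal_add_gaussianReal_of_indepFun (P := (gaussianReal 0 v₁).prod
    (gaussianReal 0 v₂)) (m₁ := 0) (v₁ := ⟨r ^ 2, sq_nonneg r⟩ * v₁) (m₂ := 0) (v₂ := v₂) hind ?_ ?_
  · have h2 : (⟨r ^ 2, sq_nonneg r⟩ * v₁ + v₂ : ℝ≥0) = v := by
      apply NNReal.coe_injective; rw [hv]; rfl
    rw [h2, add_zero] at this
    exact this
  · have h3 : (gaussianReal 0 v₁).map (fun x => r * x) =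
        gaussianReal 0 (⟨r ^ 2, sq_nonneg r⟩ * v₁) := by
      rw [gaussianReal_map_const_mul, mul_zero]
      rfl
    rw [← h3]
    have h5 := Measure.map_map (μ := (gaussianReal 0 v₁).prod (gaussianReal 0 v₂))
      (f := Prod.fst) (g := fun x : ℝ => r * x) (by fun_prop) measurable_fst
    rw [Measure.map_fst_prod, measure_univ, one_smul] at h5
    exact h5.symm
  · exact (Measure.map_snd_prod (μ := gaussianReal 0 v₁) (ν := gaussianReal 0 v₂)).trans (by simp)

/-- A linear combination of two independent Gaussian vectors with i.i.d. entries. -/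
lemma map_linear_prod_gaussPi (r : ℝ) (v₁ v₂ v : ℝ≥0) (hv : (v : ℝ) = r ^ 2 * v₁ + v₂) :
    ((gaussPi ι v₁).prod (gaussPi ι v₂)).map (fun p i => r * p.1 i + p.2 i) = gaussPi ι v := by
  have hsingle := map_linear_prod_gaussianReal r v₁ v₂ v hv
  have hmp := (measurePreserving_arrowProdEquivProdArrow ℝ ℝ ι (fun _ => gaussianReal 0 v₁)
    (fun _ => gaussianReal 0 v₂)).map_eq
  unfold gaussPi
  rw [← hmp, Measure.map_map (by fun_prop) (MeasurableEquiv.measurable _)]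
  have : SigmaFinite (((gaussianReal 0 v₁).prod (gaussianReal 0 v₂)).map
      (fun p : ℝ × ℝ => r * p.1 + p.2)) := by rw [hsingle]; infer_instance
  have h4 := Measure.pi_map_pi (ι := ι) (μ := fun _ => (gaussianReal 0 v₁).prod (gaussianReal 0 v₂))
    (f := fun _ (p : ℝ × ℝ) => r * p.1 + p.2) (fun _ => by fun_prop)
  simp_rw [hsingle] at h4
  rw [← h4]
  rfl

lemma memLp_sq_gaussianReal (v : ℝ≥0) : MemLp (fun x : ℝ => x ^ 2) 2 (gaussianReal 0 v) := by
  rw [memLp_two_iff_integrable_sq (by fun_prop)]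
  have := (memLp_id_gaussianReal (μ := 0) (v := v) 4).integrable_norm_pow (by norm_num)
  refine this.congr (ae_of_all _ fun x => ?_)
  simp only [id, Real.norm_eq_abs]
  rw [← pow_mul, show 2 * 2 = 4 from rfl, Even.pow_abs (by decide)]

lemma integral_sq_gaussianReal (v : ℝ≥0) : ∫ x, x ^ 2 ∂(gaussianReal 0 v) = v := by
  have h := variance_fun_id_gaussianReal (μ := 0) (v := v)
  rw [variance_of_integral_eq_zero (by fun_prop) (by simp)] at h
  exact h

lemma measurePreserving_eval_gaussPi (v : ℝ≥0) (i : ι) :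
    MeasurePreserving (Function.eval i) (gaussPi ι v) (gaussianReal 0 v) :=
  measurePreserving_eval (fun _ => gaussianReal 0 v) i

lemma integrable_eval_gaussPi (v : ℝ≥0) (i : ι) :
    Integrable (fun x : ι → ℝ => x i) (gaussPi ι v) :=
  integrable_comp_eval (μ := fun _ : ι => gaussianReal 0 v) (f := fun x : ℝ => x)
    ((memLp_id_gaussianReal (μ := 0) (v := v) 1).integrable (by simp))

lemma integral_eval_gaussPi (v : ℝ≥0) (i : ι) : ∫ x, x i ∂(gaussPi ι v) = 0 := by
  unfold gaussPi
  rw [integral_comp_eval (μ := fun _ : ι => gaussianReal 0 v) (f := fun x : ℝ => x)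
    (by fun_prop)]
  simp

lemma integrable_eval_sq_gaussPi (v : ℝ≥0) (i : ι) :
    Integrable (fun x : ι → ℝ => x i ^ 2) (gaussPi ι v) :=
  integrable_comp_eval (μ := fun _ : ι => gaussianReal 0 v) (f := fun x : ℝ => x ^ 2)
    ((memLp_sq_gaussianReal v).integrable (by simp))

lemma integral_eval_sq_gaussPi (v : ℝ≥0) (i : ι) : ∫ x, x i ^ 2 ∂(gaussPi ι v) = v := by
  unfold gaussPi
  rw [integral_comp_eval (μ := fun _ : ι => gaussianReal 0 v) (f := fun x : ℝ => x ^ 2)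
    (by fun_prop), integral_sq_gaussianReal]

lemma integrable_sum_sq_gaussPi (v : ℝ≥0) :
    Integrable (fun x : ι → ℝ => ∑ i, x i ^ 2) (gaussPi ι v) :=
  integrable_finsetSum _ fun i _ => integrable_eval_sq_gaussPi v i

/-- The law of large numbers for i.i.d. copies in Chebyshev form. -/
lemma measure_sum_deviation_le {Ω : Type*} [MeasurableSpace Ω] (μ : Measure Ω)
    [IsProbabilityMeasure μ] {f : Ω → ℝ} (hf : MemLp f 2 μ) {a : ℝ} (ha : 0 < a)
    (hι : 0 < Fintype.card ι) :
    (Measure.pi fun _ : ι => μ) {x | Fintype.card ι * a ≤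
        |∑ i, f (x i) - Fintype.card ι * ∫ y, f y ∂μ|} ≤
      ENNReal.ofReal (variance f μ / (Fintype.card ι * a ^ 2)) := by
  have hi : ∀ i : ι, MemLp (fun x : ι → Ω => f (x i)) 2 (Measure.pi fun _ : ι => μ) := fun i =>
    hf.comp_measurePreserving (measurePreserving_eval _ i)
  have hmem : MemLp (∑ i, fun x : ι → Ω => f (x i)) 2 (Measure.pi fun _ : ι => μ) := by
    have := memLp_finsetSum (s := Finset.univ) (f := fun i (x : ι → Ω) => f (x i))
      (fun i _ => hi i)
    convert! this using 1
    ext x; simp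
  have hcard : (0 : ℝ) < Fintype.card ι := by exact_mod_cast hι
  have h := meas_ge_le_variance_div_sq hmem (c := Fintype.card ι * a) (by positivity)
  rw [variance_sum_pi fun _ => hf] at h
  have hE : ∫ x, (∑ i, fun x : ι → Ω => f (x i)) x ∂(Measure.pi fun _ : ι => μ) =
      Fintype.card ι * ∫ y, f y ∂μ := by
    simp only [Finset.sum_apply]
    rw [integral_finsetSum _ fun i _ => (hi i).integrable (by simp)]
    simp_rw [integral_comp_eval (μ := fun _ : ι => μ) (f := f) hf.aestronglyMeasurable]
    simp
  rw [hE] at h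
  simp only [Finset.sum_apply, Finset.sum_const, Finset.card_univ, nsmul_eq_mul] at h
  refine h.trans_eq ?_
  congr 1
  field_simp

end

/-! ### Threshold and genie parameters -/

/-- The left side of the threshold equation increases and the right side decreases, so below the
solution the equation becomes a strict inequality. -/
lemma existsUnique_isThreshold (θ P : ℝ) (hθ : θ ∈ Set.Ioo 0 (Real.pi / 2)) (hP : 0 ≤ P) :
    ∃ h₀ : ℝ, (IsThreshold θ P h₀ ∧ ∀ x, IsThreshold θ P x → x = h₀) ∧
      ∀ x, 0 ≤ x → x < h₀ →
        x ^ 2 - Real.sin θ ^ 2 < max 0 (Real.cos θ / (1 + x ^ 2 * P) - x) ^ 2 := by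
  have hs : 0 < Real.sin θ := Real.sin_pos_of_pos_of_lt_pi hθ.1 (by linarith [hθ.2, Real.pi_pos])
  have hc : 0 < Real.cos θ := Real.cos_pos_of_mem_Ioo ⟨by linarith [hθ.1, Real.pi_pos], hθ.2⟩
  set f : ℝ → ℝ := fun x =>
    x ^ 2 - Real.sin θ ^ 2 - max 0 (Real.cos θ / (1 + x ^ 2 * P) - x) ^ 2 with hf
  have hcont : Continuous f := by
    have : ∀ x : ℝ, 1 + x ^ 2 * P ≠ 0 := fun x => by positivity
    fun_prop (disch := exact this _)
  have hmono : ∀ x y, 0 ≤ x → x < y → f x < f y := by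
    intro x y hx hxy
    have h1 : x ^ 2 < y ^ 2 := by nlinarith
    have h2 : Real.cos θ / (1 + y ^ 2 * P) ≤ Real.cos θ / (1 + x ^ 2 * P) := by gcongr
    have h3 : max 0 (Real.cos θ / (1 + y ^ 2 * P) - y) ≤
        max 0 (Real.cos θ / (1 + x ^ 2 * P) - x) := max_le_max le_rfl (by linarith)
    have h4 := pow_le_pow_left₀ (le_max_left _ _) h3 2
    simp only [hf]
    linarith
  have h0 : f 0 < 0 := by
    simp only [hf]
    have : 0 ≤ max 0 (Real.cos θ / (1 + (0 : ℝ) ^ 2 * P) - 0) ^ 2 := sq_nonneg _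
    nlinarith
  have h1 : 0 ≤ f 1 := by
    have h5 : Real.cos θ / (1 + (1 : ℝ) ^ 2 * P) ≤ 1 := by
      rw [div_le_one (by positivity)]
      nlinarith [Real.cos_le_one θ]
    have : max 0 (Real.cos θ / (1 + (1 : ℝ) ^ 2 * P) - 1) = 0 := max_eq_left (by linarith)
    simp only [hf, this]
    nlinarith [Real.sin_le_one θ]
  obtain ⟨x₀, hx₀, hfx⟩ := intermediate_value_Icc (zero_le_one' ℝ) hcont.continuousOn ⟨h0.le, h1⟩
  have hpos : 0 < x₀ := lt_of_le_of_ne hx₀.1 (by rintro rfl; linarith)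
  refine ⟨x₀, ⟨⟨hpos, sub_eq_zero.1 hfx⟩, fun x hx => ?_⟩, fun x hx hlt => ?_⟩
  · have hx' : f x = 0 := sub_eq_zero.2 hx.2
    rcases lt_trichotomy x x₀ with h | h | h
    · linarith [hmono x x₀ hx.1.le h]
    · exact h
    · linarith [hmono x₀ x hpos.le h]
  · exact sub_neg.1 ((hmono x x₀ hx hlt).trans_eq hfx)

/-- The parameters of the genie. Receiver `i` is given the side information `h cᵀ Xᵢ + g U`, where
the receiver noise is `p U + g V` with `U`, `V` independent standard Gaussian. The linear estimate
of the received symbol from the side information has coefficient `l`, and `t` is the largest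
eigenvalue of the quadratic form of the estimation error plus the interference, attained along the
beam. In the orthonormal coordinates in which `c = (1, 0)` and `d = (C, s)`, the beam is
proportional to `(C / (1 + h² P), s)`. The last equation says that the estimation error variance at
the beam, divided by `g²`, is one plus the signal to interference and noise ratio. -/
lemma exists_genie_parameters {C s P h : ℝ} (hC : 0 < C) (hs : 0 < s) (hP : 0 ≤ P)
    (hh : h ^ 2 - s ^ 2 < max 0 (C / (1 + h ^ 2 * P) - |h|) ^ 2) :
    ∃ g p l t : ℝ, 0 < g ∧ 0 ≤ t ∧ p ^ 2 + g ^ 2 = 1 ∧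
      (∀ α β : ℝ, ((C - l * h) * α + s * β) ^ 2 + h ^ 2 * α ^ 2 ≤ t * (α ^ 2 + β ^ 2)) ∧
      P * t + ((p - l * g) ^ 2 + g ^ 2) =
        g ^ 2 * (1 + P * C ^ 2 / (1 + h ^ 2 * P) + P * s ^ 2) := by
  obtain ⟨k, hk⟩ : ∃ k, k = C / (1 + h ^ 2 * P) := ⟨_, rfl⟩
  rw [← hk] at hh
  have hden : 0 < 1 + h ^ 2 * P := by positivity
  have hk0 : 0 < k := by rw [hk]; positivity
  have hCk : C = k * (1 + h ^ 2 * P) := by rw [hk]; field_simp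
  have hH0 : 0 ≤ |h| := abs_nonneg h
  have hHh : h ^ 2 = |h| ^ 2 := (sq_abs h).symm
  generalize |h| = H at *
  obtain ⟨r2, hr2⟩ : ∃ r2, r2 = k ^ 2 + s ^ 2 := ⟨_, rfl⟩
  have hr2pos : 0 < r2 := by rw [hr2]; positivity
  -- The threshold condition amounts to these two facts.
  have hA : 2 * H * k ≤ r2 ∧ (s < H → H < k) := by
    rcases le_total k H with h1 | h1
    · rw [max_eq_left (by linarith), hHh] at hh
      have : H < s := by nlinarith
      exact ⟨by nlinarith, fun h2 => by linarith⟩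
    · rw [max_eq_right (by linarith), hHh] at hh
      refine ⟨by nlinarith, fun h2 => lt_of_le_of_ne h1 ?_⟩
      rintro h3
      rw [h3] at hh h2
      nlinarith
  have hdisc : 0 ≤ r2 ^ 2 - 4 * (H ^ 2 * k ^ 2) := by nlinarith [mul_nonneg hH0 hk0.le]
  obtain ⟨D, hD0, hDsq⟩ : ∃ D, 0 ≤ D ∧ D ^ 2 = r2 ^ 2 - 4 * (H ^ 2 * k ^ 2) :=
    ⟨_, Real.sqrt_nonneg _, Real.sq_sqrt hdisc⟩
  obtain ⟨t, ht⟩ : ∃ t, t = (r2 + D) / 2 := ⟨_, rfl⟩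
  have htpos : 0 < t := by rw [ht]; positivity
  have hq : t ^ 2 - r2 * t + h ^ 2 * k ^ 2 = 0 := by
    rw [hHh, ht]; linear_combination hDsq / 4
  have htle : t ≤ r2 := by
    have : h ^ 2 * k ^ 2 = t * (r2 - t) := by linarith
    by_contra hcon
    nlinarith [mul_nonneg (sq_nonneg h) (sq_nonneg k), mul_pos htpos (sub_pos.2 (not_le.1 hcon))]
  have htHs : H * s ≤ t := by
    by_cases h1 : H ≤ s
    · by_contra hcon
      rw [not_le] at hcon
      have h2 : 0 < (H * s - t) * (H * s - (r2 - t)) :=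
        mul_pos (by linarith) (by linarith)
      have h3 : (H * s - t) * (H * s - (r2 - t)) = H * r2 * (H - s) := by
        rw [hHh] at hq; rw [hr2] at hq ⊢; linear_combination -hq
      nlinarith [mul_nonneg hH0 hr2pos.le]
    · rw [not_le] at h1
      have h2 := hA.2 h1
      have h3 : H * k ≤ t := by
        refine abs_le_of_sq_le_sq' ?_ htpos.le |>.2
        have : (H * k) ^ 2 = t * (r2 - t) := by rw [hHh] at hq; linarith
        rw [this]; nlinarith
      nlinarith
  -- The covariance `p g = h k / r2` of receiver noise and genie noise makes the side information
  -- redundant for the beamformed Gaussian input. Then `g² = t / r2` solves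
  -- `g² (1 - g²) = (p g)²`, and of the two roots the larger makes `t` the top eigenvalue.
  refine ⟨Real.sqrt (t / r2), h * k / r2 / Real.sqrt (t / r2), h * k * (P + 1 / t), t,
    Real.sqrt_pos.2 (by positivity), htpos.le, ?_, fun α β => ?_, ?_⟩
  · rw [div_pow, Real.sq_sqrt (by positivity)]
    field_simp
    linear_combination hq
  · have ha : t * (C - h * k * (P + 1 / t) * h) = k * (t - h ^ 2) := by
      rw [hCk]; field_simp; ring
    generalize C - h * k * (P + 1 / t) * h = a at *
    obtain ⟨E, hE⟩ : ∃ E, E = t * (α ^ 2 + β ^ 2) - ((a * α + s * β) ^ 2 + h ^ 2 * α ^ 2) :=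
      ⟨_, rfl⟩
    -- The gap to `t` is a multiple of the square of the component orthogonal to the beam.
    have key : t * (t * r2 * E - (t ^ 2 - h ^ 2 * s ^ 2) * (s * α - k * β) ^ 2) = 0 := by
      rw [hE]
      rw [hr2] at hq ⊢
      linear_combination (α ^ 2 * ((t - h ^ 2) * (k ^ 2 + s ^ 2) - t * s ^ 2) +
          2 * s * k * t * α * β + s ^ 2 * t * β ^ 2) * hq +
        (-(k ^ 2 + s ^ 2) * α ^ 2 * (t * a + k * (t - h ^ 2)) -
          2 * s * α * β * t * (k ^ 2 + s ^ 2)) * ha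
    have h1 : t * r2 * E = (t ^ 2 - h ^ 2 * s ^ 2) * (s * α - k * β) ^ 2 := by
      rcases mul_eq_zero.1 key with h | h
      · exact absurd h htpos.ne'
      · linarith
    have h2 : 0 ≤ t ^ 2 - h ^ 2 * s ^ 2 := by
      have := pow_le_pow_left₀ (mul_nonneg hH0 hs.le) htHs 2
      rw [mul_pow] at this
      rw [hHh]; linarith
    have h3 : 0 ≤ t * r2 * E := h1 ▸ mul_nonneg h2 (sq_nonneg _)
    have h4 : 0 ≤ E := nonneg_of_mul_nonneg_right h3 (by positivity)
    linarith
  · have hg : Real.sqrt (t / r2) ^ 2 = t / r2 := Real.sq_sqrt (by positivity)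
    have hg0 : 0 < Real.sqrt (t / r2) := Real.sqrt_pos.2 (by positivity)
    generalize Real.sqrt (t / r2) = g at *
    have hpg : h * k / r2 / g * g = h * k / r2 := by field_simp
    have hp2 : (h * k / r2 / g) ^ 2 = 1 - t / r2 := by
      rw [div_pow, hg]; field_simp; linear_combination hq
    have hCC : P * C ^ 2 / (1 + h ^ 2 * P) = P * (k * C) := by rw [hk]; ring
    rw [hCC]
    have : (h * k / r2 / g - h * k * (P + 1 / t) * g) ^ 2 + g ^ 2 =
        1 - 2 * (h * k * (P + 1 / t)) * (h * k / r2) + (h * k * (P + 1 / t)) ^ 2 * (t / r2) := by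
      linear_combination hp2 - 2 * (h * k * (P + 1 / t)) * hpg +
        (1 + (h * k * (P + 1 / t)) ^ 2) * hg
    rw [this, hg, hCk]
    field_simp
    rw [hr2] at hq ⊢
    linear_combination -hq

section Beam

variable {m : ℕ} {d c : EuclideanSpace ℝ (Fin m)} {h P : ℝ}

lemma beamDirection_eq (hc : ‖c‖ = 1) (hP : 0 ≤ P) :
    beamDirection d c h P = d - (h ^ 2 * P / (1 + h ^ 2 * P) * inner ℝ c d) • c := by
  have hden : 1 + h ^ 2 * P ≠ 0 := by positivity
  have hcc : (c.ofLp ⬝ᵥ c.ofLp) = 1 := by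
    have := EuclideanSpace.real_norm_sq_eq c
    rw [hc] at this
    simp [dotProduct, ← pow_two, ← this]
  have hinv : (1 + (h ^ 2 * P) • Matrix.vecMulVec c c : Matrix (Fin m) (Fin m) ℝ)⁻¹ =
      1 - (h ^ 2 * P / (1 + h ^ 2 * P)) • Matrix.vecMulVec c c := by
    refine Matrix.inv_eq_right_inv ?_
    have hsq : Matrix.vecMulVec c.ofLp c.ofLp * Matrix.vecMulVec c.ofLp c.ofLp =
        Matrix.vecMulVec c.ofLp c.ofLp := by
      rw [Matrix.vecMulVec_mul_vecMulVec, hcc]; simp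
    rw [add_mul, mul_sub, mul_sub, one_mul, one_mul, mul_one, Matrix.smul_mul, Matrix.mul_smul,
      hsq, smul_smul]
    have : (h ^ 2 * P) * (h ^ 2 * P / (1 + h ^ 2 * P)) =
        h ^ 2 * P - h ^ 2 * P / (1 + h ^ 2 * P) := by field_simp; ring
    rw [this, sub_smul]
    abel
  unfold beamDirection
  rw [hinv]
  ext i
  simp only [Matrix.sub_mulVec, Matrix.one_mulVec, Matrix.smul_mulVec, Matrix.vecMulVec_mulVec,
    PiLp.sub_apply, PiLp.smul_apply, Pi.sub_apply, Pi.smul_apply, smul_eq_mul, MulOpposite.smul_eq_mul_unop, MulOpposite.unop_op]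
  rw [PiLp.inner_apply]
  simp only [dotProduct, RCLike.inner_apply, conj_trivial]
  simp_rw [mul_comm]
  ring

end Beam

/-! ### The beam, and the rate of treating interference as noise -/

section Beam

variable {m : ℕ} {d c : EuclideanSpace ℝ (Fin m)} {h P θ : ℝ}

lemma inner_eq_cos_angle (hd : ‖d‖ = 1) (hc : ‖c‖ = 1)
    (hθ : InnerProductGeometry.angle d c = θ) : inner ℝ d c = Real.cos θ := by
  rw [← hθ, InnerProductGeometry.cos_angle, hd, hc]
  simp

lemma inner_signal_beamDirection (hd : ‖d‖ = 1) (hc : ‖c‖ = 1)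
    (hθ : InnerProductGeometry.angle d c = θ) (hP : 0 ≤ P) :
    inner ℝ d (beamDirection d c h P) =
      Real.cos θ ^ 2 / (1 + h ^ 2 * P) + Real.sin θ ^ 2 := by
  have hden : 1 + h ^ 2 * P ≠ 0 := by positivity
  rw [beamDirection_eq hc hP, inner_sub_right, inner_smul_right, real_inner_self_eq_norm_sq, hd,
    real_inner_comm d c, inner_eq_cos_angle hd hc hθ, Real.sin_sq]
  field_simp
  ring

lemma inner_interference_beamDirection (hd : ‖d‖ = 1) (hc : ‖c‖ = 1)
    (hθ : InnerProductGeometry.angle d c = θ) (hP : 0 ≤ P) :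
    inner ℝ c (beamDirection d c h P) = Real.cos θ / (1 + h ^ 2 * P) := by
  have hden : 1 + h ^ 2 * P ≠ 0 := by positivity
  rw [beamDirection_eq hc hP, inner_sub_right, inner_smul_right, real_inner_self_eq_norm_sq, hc,
    real_inner_comm d c, inner_eq_cos_angle hd hc hθ]
  field_simp
  ring

lemma norm_sq_beamDirection (hd : ‖d‖ = 1) (hc : ‖c‖ = 1)
    (hθ : InnerProductGeometry.angle d c = θ) (hP : 0 ≤ P) :
    ‖beamDirection d c h P‖ ^ 2 =
      (Real.cos θ / (1 + h ^ 2 * P)) ^ 2 + Real.sin θ ^ 2 := by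
  have hden : 1 + h ^ 2 * P ≠ 0 := by positivity
  rw [beamDirection_eq hc hP, norm_sub_sq_real, inner_smul_right, norm_smul, mul_pow, hd, hc,
    real_inner_comm d c, inner_eq_cos_angle hd hc hθ, Real.norm_eq_abs, sq_abs, Real.sin_sq]
  field_simp
  ring

lemma beamDirection_ne_zero (hd : ‖d‖ = 1) (hc : ‖c‖ = 1)
    (hθ : InnerProductGeometry.angle d c = θ) (hsin : 0 < Real.sin θ) (hP : 0 ≤ P) :
    beamDirection d c h P ≠ 0 := by
  intro h0
  have := norm_sq_beamDirection (h := h) hd hc hθ hP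
  rw [h0] at this
  simp only [norm_zero] at this
  nlinarith [sq_nonneg (Real.cos θ / (1 + h ^ 2 * P))]

lemma norm_beam (hb : beamDirection d c h P ≠ 0) : ‖beam d c h P‖ = 1 := by
  rw [beam, norm_smul, norm_inv, norm_norm, inv_mul_cancel₀ (norm_ne_zero_iff.2 hb)]

/-- The beam turns the channel into one with signal to interference and noise ratio
`P cos² θ / (1 + h² P) + P sin² θ`. -/
lemma beam_sinr (hd : ‖d‖ = 1) (hc : ‖c‖ = 1)
    (hθ : InnerProductGeometry.angle d c = θ) (hsin : 0 < Real.sin θ) (hP : 0 ≤ P) :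
    P * inner ℝ d (beam d c h P) ^ 2 / (1 + h ^ 2 * (P * inner ℝ c (beam d c h P) ^ 2)) =
      P * Real.cos θ ^ 2 / (1 + h ^ 2 * P) + P * Real.sin θ ^ 2 := by
  have hden : 0 < 1 + h ^ 2 * P := by positivity
  have hn := norm_sq_beamDirection (h := h) hd hc hθ hP
  have hn0 : ‖beamDirection d c h P‖ ≠ 0 :=
    norm_ne_zero_iff.2 (beamDirection_ne_zero hd hc hθ hsin hP)
  rw [beam, inner_smul_right, inner_smul_right, inner_signal_beamDirection hd hc hθ hP,
    inner_interference_beamDirection hd hc hθ hP, mul_pow, mul_pow, inv_pow, hn]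
  have h1 : 0 < (Real.cos θ / (1 + h ^ 2 * P)) ^ 2 + Real.sin θ ^ 2 := by positivity
  have h2 : 1 + h ^ 2 * (P * (((Real.cos θ / (1 + h ^ 2 * P)) ^ 2 + Real.sin θ ^ 2)⁻¹ *
      (Real.cos θ / (1 + h ^ 2 * P)) ^ 2)) =
      (Real.cos θ ^ 2 / (1 + h ^ 2 * P) + Real.sin θ ^ 2) /
        ((Real.cos θ / (1 + h ^ 2 * P)) ^ 2 + Real.sin θ ^ 2) := by
    field_simp
    ring
  have h3 : 0 < Real.cos θ ^ 2 / (1 + h ^ 2 * P) + Real.sin θ ^ 2 := by positivity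
  rw [h2]
  field_simp

lemma posSemidef_beamCovariance (b : EuclideanSpace ℝ (Fin m)) (hP : 0 ≤ P) :
    (beamCovariance b P).PosSemidef := by
  have := (Matrix.posSemidef_vecMulVec_self_star (R := ℝ) b.ofLp).smul hP
  simpa [beamCovariance] using this

lemma trace_vecMulVec_self (x : EuclideanSpace ℝ (Fin m)) :
    (Matrix.vecMulVec x.ofLp x.ofLp).trace = ‖x‖ ^ 2 := by
  rw [Matrix.trace_vecMulVec, EuclideanSpace.real_norm_sq_eq]
  simp [dotProduct, pow_two]

lemma beamCovariance_mem (b : EuclideanSpace ℝ (Fin m)) (hb : ‖b‖ = 1) (hP : 0 ≤ P) :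
    beamCovariance b P ∈ covarianceConstraint m P := by
  refine ⟨posSemidef_beamCovariance b hP, ?_⟩
  rw [beamCovariance, Matrix.trace_smul, trace_vecMulVec_self, hb]
  simp

lemma dotProduct_beamCovariance (b x : EuclideanSpace ℝ (Fin m)) :
    x.ofLp ⬝ᵥ (beamCovariance b P).mulVec x.ofLp = P * inner ℝ x b ^ 2 := by
  have : x.ofLp ⬝ᵥ b.ofLp = inner ℝ x b := by
    simp [PiLp.inner_apply, dotProduct, mul_comm]
  rw [beamCovariance, Matrix.smul_mulVec, Matrix.vecMulVec_mulVec, dotProduct_smul]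
  rw [dotProduct_smul, dotProduct_comm b.ofLp, this, MulOpposite.smul_eq_mul_unop,
    MulOpposite.unop_op, smul_eq_mul]
  ring

end Beam

section TreatingInterferenceAsNoise

variable {m : ℕ}

lemma map_inner_multivariateGaussian {Q : Matrix (Fin m) (Fin m) ℝ} (hQ : Q.PosSemidef)
    (x : EuclideanSpace ℝ (Fin m)) :
    (multivariateGaussian 0 Q).map (fun y => inner ℝ x y) =
      gaussianReal 0 (x.ofLp ⬝ᵥ Q.mulVec x.ofLp).toNNReal := by
  have h := IsGaussian.map_eq_gaussianReal (μ := multivariateGaussian 0 Q) (innerSL ℝ x)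
  have h0 : ∫ y, innerSL ℝ x y ∂(multivariateGaussian 0 Q) = 0 := by
    rw [ContinuousLinearMap.integral_comp_comm _ IsGaussian.integrable_fun_id]
    simp
  rw [h0] at h
  have hv : Var[innerSL ℝ x; multivariateGaussian 0 Q] = x.ofLp ⬝ᵥ Q.mulVec x.ofLp := by
    rw [← covarianceBilin_multivariateGaussian hQ (μ := 0), covarianceBilin_self IsGaussian.memLp_two_id]
    rfl
  rw [hv] at h
  exact h

/-- The mutual information between a signal and its observation in Gaussian noise, when the
observed linear functional `L` of the signal is Gaussian. -/
lemma klDiv_signal_plus_noise {E : Type*} [MeasurableSpace E] (μ : Measure E)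
    [IsProbabilityMeasure μ] {L : E → ℝ} (hL : Measurable L) {v₁ v₂ v : ℝ≥0}
    (hv₂ : v₂ ≠ 0) (hv : v = v₁ + v₂) (hμ : μ.map L = gaussianReal 0 v₁) :
    InformationTheory.klDiv ((μ.prod (gaussianReal 0 v₂)).map fun p => (p.1, L p.1 + p.2))
      (μ.prod (gaussianReal 0 v)) = ENNReal.ofReal (1 / 2 * Real.log (v / v₂)) := by
  have hv0 : v ≠ 0 := by rw [hv]; simp [hv₂]
  have hv₂' : (0 : ℝ) < v₂ := by positivity
  have hv' : (0 : ℝ) < v := by positivity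
  set T : E × ℝ → E × ℝ := fun p => (p.1, L p.1 + p.2) with hT
  have hTm : Measurable T := by fun_prop
  set ρ : E × ℝ → ℝ := fun p => gaussianPDFReal 0 v₂ (p.2 - L p.1) / gaussianPDFReal 0 v p.2
  have hρm : Measurable ρ := by
    have h1 := measurable_gaussianPDFReal 0 v₂
    have h2 := measurable_gaussianPDFReal 0 v
    fun_prop
  have hρpos : ∀ p, 0 < ρ p := fun p =>
    div_pos (gaussianPDFReal_pos _ _ _ hv₂) (gaussianPDFReal_pos _ _ _ hv0)
  have hJ : (μ.prod (gaussianReal 0 v₂)).map T =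
      (μ.prod (gaussianReal 0 v)).withDensity fun p => ENNReal.ofReal (ρ p) := by
    refine Measure.ext_of_lintegral _ fun φ hφ => ?_
    rw [lintegral_map hφ hTm, lintegral_prod _ (by fun_prop),
      lintegral_withDensity_eq_lintegral_mul _ (by fun_prop) hφ, lintegral_prod _ (by fun_prop)]
    refine lintegral_congr fun x => ?_
    have hg : ∀ w : ℝ≥0, Measurable (gaussianPDF 0 w) := measurable_gaussianPDF 0
    rw [gaussianReal_of_var_ne_zero _ hv₂, gaussianReal_of_var_ne_zero _ hv0,
      lintegral_withDensity_eq_lintegral_mul _ (hg _) (by fun_prop),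
      lintegral_withDensity_eq_lintegral_mul _ (hg _) (by fun_prop),
      ← lintegral_sub_right_eq_self _ (L x)]
    refine lintegral_congr fun y => ?_
    simp only [Pi.mul_apply, hT, add_sub_cancel, ρ, gaussianPDF]
    rw [← mul_assoc, ← ENNReal.ofReal_mul (gaussianPDFReal_nonneg _ _ _),
      mul_div_cancel₀ _ (gaussianPDFReal_pos _ _ _ hv0).ne']
  have hac : (μ.prod (gaussianReal 0 v₂)).map T ≪ μ.prod (gaussianReal 0 v) :=
    hJ ▸ withDensity_absolutelyContinuous _ _
  have hprob : IsProbabilityMeasure ((μ.prod (gaussianReal 0 v₂)).map T) :=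
    Measure.isProbabilityMeasure_map hTm.aemeasurable
  have hllr : llr ((μ.prod (gaussianReal 0 v₂)).map T) (μ.prod (gaussianReal 0 v))
      =ᵐ[(μ.prod (gaussianReal 0 v₂)).map T] fun p => Real.log (ρ p) := by
    refine hac.ae_le ?_
    have h1 := Measure.rnDeriv_withDensity (μ.prod (gaussianReal 0 v))
      (f := fun p => ENNReal.ofReal (ρ p)) (by fun_prop)
    rw [← hJ] at h1
    filter_upwards [h1] with p hp
    rw [llr, hp, ENNReal.toReal_ofReal (hρpos p).le]
  have hlog : ∀ p, Real.log (ρ (T p)) =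
      1 / 2 * Real.log (v / v₂) - p.2 ^ 2 / (2 * v₂) + (L p.1 + p.2) ^ 2 / (2 * v) := by
    intro p
    simp only [ρ, hT, add_sub_cancel_left]
    have h : ∀ (w : ℝ≥0) (y : ℝ), w ≠ 0 → Real.log (gaussianPDFReal 0 w y) =
        -(1 / 2 * Real.log (2 * Real.pi)) - 1 / 2 * Real.log w - y ^ 2 / (2 * w) := by
      intro w y hw
      have hw' : (0 : ℝ) < w := by positivity
      rw [gaussianPDFReal, Real.log_mul (by positivity) (by positivity), Real.log_exp,
        Real.log_inv, Real.log_sqrt (by positivity), Real.log_mul (by positivity) (by positivity)]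
      ring
    rw [Real.log_div (gaussianPDFReal_pos _ _ _ hv₂).ne' (gaussianPDFReal_pos _ _ _ hv0).ne',
      h _ _ hv₂, h _ _ hv0, Real.log_div hv'.ne' hv₂'.ne']
    ring
  -- Laws of the noise and of the observation.
  have hnoise : MeasurePreserving (fun p : E × ℝ => p.2) (μ.prod (gaussianReal 0 v₂))
      (gaussianReal 0 v₂) := measurePreserving_snd
  have hobs : MeasurePreserving (fun p : E × ℝ => L p.1 + p.2) (μ.prod (gaussianReal 0 v₂))
      (gaussianReal 0 v) := by
    refine ⟨by fun_prop, ?_⟩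
    rw [← map_linear_prod_gaussianReal 1 v₁ v₂ v (by rw [hv]; push_cast; ring), ← hμ]
    nth_rewrite 2 [← Measure.map_id (μ := gaussianReal 0 v₂)]
    rw [Measure.map_prod_map _ _ hL measurable_id, Measure.map_map (by fun_prop) (by fun_prop)]
    congr 1
    ext p
    simp
  have hsq : ∀ w : ℝ≥0, Integrable (fun x : ℝ => x ^ 2) (gaussianReal 0 w) := fun w =>
    (memLp_sq_gaussianReal w).integrable (by simp)
  have hi1 : Integrable (fun p : E × ℝ => p.2 ^ 2) (μ.prod (gaussianReal 0 v₂)) :=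
    hnoise.integrable_comp_of_integrable (hsq v₂)
  have hi2 : Integrable (fun p : E × ℝ => (L p.1 + p.2) ^ 2) (μ.prod (gaussianReal 0 v₂)) :=
    hobs.integrable_comp_of_integrable (hsq v)
  have hE1 : ∫ p : E × ℝ, p.2 ^ 2 ∂(μ.prod (gaussianReal 0 v₂)) = v₂ := by
    rw [← integral_sq_gaussianReal v₂, ← hnoise.map_eq, integral_map (by fun_prop) (by fun_prop)]
    simp
  have hE2 : ∫ p : E × ℝ, (L p.1 + p.2) ^ 2 ∂(μ.prod (gaussianReal 0 v₂)) = v := by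
    rw [← integral_sq_gaussianReal v, ← hobs.map_eq, integral_map (by fun_prop) (by fun_prop)]
  have hlogm : ∀ ν : Measure (E × ℝ), AEStronglyMeasurable (fun p => Real.log (ρ p)) ν :=
    fun ν => (Real.measurable_log.comp hρm).aestronglyMeasurable
  have hint : Integrable (fun p => Real.log (ρ p)) ((μ.prod (gaussianReal 0 v₂)).map T) := by
    rw [integrable_map_measure (hlogm _) hTm.aemeasurable]
    refine Integrable.congr (f := fun p => 1 / 2 * Real.log (v / v₂) - p.2 ^ 2 / (2 * v₂) +
      (L p.1 + p.2) ^ 2 / (2 * v)) ?_ (ae_of_all _ fun p => (hlog p).symm)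
    exact ((integrable_const _).sub (hi1.div_const _)).add (hi2.div_const _)
  rw [InformationTheory.klDiv_of_ac_of_integrable hac ((integrable_congr hllr).2 hint),
    integral_congr_ae hllr, integral_map (by fun_prop) (hlogm _)]
  simp_rw [hlog]
  rw [integral_add (f := fun p : E × ℝ => 1 / 2 * Real.log (v / v₂) - p.2 ^ 2 / (2 * v₂))
      ((integrable_const _).sub (hi1.div_const _)) (hi2.div_const _),
    integral_sub (f := fun _ : E × ℝ => 1 / 2 * Real.log (v / v₂)) (integrable_const _) (hi1.div_const _), integral_div, integral_div, hE1, hE2]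
  congr 1
  simp
  field_simp
  ring

lemma gaussianInputRate_eq (d c : EuclideanSpace ℝ (Fin m)) (h : ℝ)
    {Q Q' : Matrix (Fin m) (Fin m) ℝ} (hQ : Q.PosSemidef) (hQ' : Q'.PosSemidef) :
    gaussianInputRate d c h Q Q' = ENNReal.ofReal (1 / 2 * Real.log
      (1 + d.ofLp ⬝ᵥ Q.mulVec d.ofLp / (1 + h ^ 2 * (c.ofLp ⬝ᵥ Q'.mulVec c.ofLp)))) := by
  set q := d.ofLp ⬝ᵥ Q.mulVec d.ofLp with hq
  set q' := c.ofLp ⬝ᵥ Q'.mulVec c.ofLp with hq'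
  have hq0 : 0 ≤ q := by simpa using hQ.dotProduct_mulVec_nonneg d.ofLp
  have hq'0 : 0 ≤ q' := by simpa using hQ'.dotProduct_mulVec_nonneg c.ofLp
  set v₂ : ℝ≥0 := (1 + h ^ 2 * q').toNNReal with hv₂
  have hv₂c : (v₂ : ℝ) = 1 + h ^ 2 * q' := Real.coe_toNNReal _ (by positivity)
  have hv₂0 : v₂ ≠ 0 := by
    rw [← NNReal.coe_ne_zero, hv₂c]; positivity
  set μX := multivariateGaussian 0 Q
  set μX' := multivariateGaussian 0 Q'
  have hN : (μX'.prod (gaussianReal 0 1)).map (fun p => h * inner ℝ c p.1 + p.2) =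
      gaussianReal 0 v₂ := by
    rw [← map_linear_prod_gaussianReal h q'.toNNReal 1 v₂
      (by rw [hv₂c, Real.coe_toNNReal _ hq'0]; push_cast; ring),
      ← map_inner_multivariateGaussian hQ' c]
    nth_rewrite 2 [← Measure.map_id (μ := gaussianReal 0 1)]
    rw [Measure.map_prod_map _ _ (by fun_prop) measurable_id,
      Measure.map_map (by fun_prop) (by fun_prop)]
    rfl
  have hJ : (μX.prod (μX'.prod (gaussianReal 0 1))).map
      (fun ω => (ω.1, received d c h ω.1 ω.2.1 ω.2.2)) =
      (μX.prod (gaussianReal 0 v₂)).map fun p => (p.1, inner ℝ d p.1 + p.2) := by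
    rw [← hN]
    nth_rewrite 2 [← Measure.map_id (μ := μX)]
    rw [Measure.map_prod_map _ _ measurable_id (by fun_prop),
      Measure.map_map (by fun_prop) (by fun_prop)]
    congr 1
    ext ω <;> simp [received, add_assoc]
  have hX := map_inner_multivariateGaussian hQ d
  have hY : (μX.prod (μX'.prod (gaussianReal 0 1))).map
      (fun ω => received d c h ω.1 ω.2.1 ω.2.2) = gaussianReal 0 (q.toNNReal + v₂) := by
    have h1 := congrArg (fun ν => Measure.map Prod.snd ν) hJ
    have hrec : Measurable fun ω : EuclideanSpace ℝ (Fin m) × EuclideanSpace ℝ (Fin m) × ℝ =>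
        received d c h ω.1 ω.2.1 ω.2.2 := by unfold received; fun_prop
    rw [Measure.map_map measurable_snd (by fun_prop),
      Measure.map_map measurable_snd (by fun_prop)] at h1
    refine h1.trans ?_
    rw [← map_linear_prod_gaussianReal 1 q.toNNReal v₂ (q.toNNReal + v₂) (by push_cast; ring), ← hX]
    nth_rewrite 2 [← Measure.map_id (μ := gaussianReal 0 v₂)]
    rw [Measure.map_prod_map _ _ (by fun_prop) measurable_id,
      Measure.map_map (by fun_prop) (by fun_prop)]
    congr 1
    ext p
    simp
  unfold gaussianInputRate mutualInfo
  rw [hJ, hY, Measure.map_fst_prod, measure_univ, one_smul,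
    klDiv_signal_plus_noise μX (by fun_prop) hv₂0 rfl hX]
  congr 3
  push_cast
  rw [hv₂c, Real.coe_toNNReal _ hq0]
  have : 0 < 1 + h ^ 2 * q' := by positivity
  field_simp
  ring

end TreatingInterferenceAsNoise

/-! ### Gaussian mixtures -/

section UniformMixture

variable {Ω : Type*} [MeasurableSpace Ω] {M : ℕ}

/-- The uniform mixture of finitely many measures. -/
def uniformMixture (ν : Fin M → Measure Ω) : Measure Ω :=
  (M : ℝ≥0∞)⁻¹ • ∑ w, ν w

lemma isProbabilityMeasure_uniformMixture (hM : M ≠ 0) (ν : Fin M → Measure Ω)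
    [∀ w, IsProbabilityMeasure (ν w)] : IsProbabilityMeasure (uniformMixture ν) := by
  refine ⟨?_⟩
  simp only [uniformMixture, Measure.smul_apply, Measure.coe_finsetSum, Finset.sum_apply,
    measure_univ, smul_eq_mul]
  simp [ENNReal.inv_mul_cancel (by exact_mod_cast hM : (M : ℝ≥0∞) ≠ 0) (by simp)]

lemma integrable_uniformMixture (hM : M ≠ 0) {ν : Fin M → Measure Ω} {F : Ω → ℝ}
    (hF : ∀ w, Integrable F (ν w)) : Integrable F (uniformMixture ν) := by
  refine Integrable.smul_measure ?_ (by simp [hM])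
  exact integrable_finsetSum_measure.2 fun w _ => hF w

lemma integral_uniformMixture {ν : Fin M → Measure Ω} {F : Ω → ℝ}
    (hF : ∀ w, Integrable F (ν w)) :
    ∫ x, F x ∂(uniformMixture ν) = (M : ℝ)⁻¹ * ∑ w, ∫ x, F x ∂(ν w) := by
  rw [uniformMixture, integral_smul_measure, integral_finsetSum_measure fun w _ => hF w]
  simp

lemma lintegral_uniformMixture (ν : Fin M → Measure Ω) (φ : Ω → ℝ≥0∞) :
    ∫⁻ x, φ x ∂(uniformMixture ν) = (M : ℝ≥0∞)⁻¹ * ∑ w, ∫⁻ x, φ x ∂(ν w) := by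
  rw [uniformMixture, lintegral_smul_measure, lintegral_finsetSum_measure]
  rfl

end UniformMixture

section GaussianMixture

variable {ι : Type*} [Fintype ι] {M : ℕ}

/-- The law of `α w + U` for a uniformly distributed `w` and i.i.d. Gaussian noise `U`. -/
def mixLaw (v : ℝ≥0) (α : Fin M → ι → ℝ) : Measure (ι → ℝ) :=
  uniformMixture fun w => (gaussPi ι v).map fun u => α w + u

/-- The Lebesgue density of `mixLaw v α`. -/
def mixDensity (v : ℝ≥0) (α : Fin M → ι → ℝ) (x : ι → ℝ) : ℝ :=
  (M : ℝ)⁻¹ * ∑ w, gaussDensity v (x - α w)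

lemma measurable_mixDensity (v : ℝ≥0) (α : Fin M → ι → ℝ) : Measurable (mixDensity v α) := by
  have := measurable_gaussDensity (ι := ι) v
  unfold mixDensity
  fun_prop

lemma le_mixDensity {v : ℝ≥0} (hv : v ≠ 0) (α : Fin M → ι → ℝ) (w : Fin M) (x : ι → ℝ) :
    (M : ℝ)⁻¹ * gaussDensity v (x - α w) ≤ mixDensity v α x :=
  mul_le_mul_of_nonneg_left (Finset.single_le_sum
    (f := fun w => gaussDensity v (x - α w)) (fun w _ => (gaussDensity_pos hv _).le)
    (Finset.mem_univ w)) (by positivity)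

lemma mixDensity_pos {v : ℝ≥0} (hv : v ≠ 0) (hM : M ≠ 0) (α : Fin M → ι → ℝ) (x : ι → ℝ) :
    0 < mixDensity v α x := by
  refine lt_of_lt_of_le ?_ (le_mixDensity hv α ⟨0, Nat.pos_of_ne_zero hM⟩ x)
  have := gaussDensity_pos hv (x - α ⟨0, Nat.pos_of_ne_zero hM⟩)
  positivity

lemma mixDensity_le (v : ℝ≥0) (hM : M ≠ 0) (α : Fin M → ι → ℝ) (x : ι → ℝ) :
    mixDensity v α x ≤ (Real.sqrt (2 * Real.pi * v))⁻¹ ^ Fintype.card ι := by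
  unfold mixDensity
  have h := Finset.sum_le_sum fun w (_ : w ∈ Finset.univ) => gaussDensity_le v (x - α w)
  simp only [Finset.sum_const, Finset.card_univ, Fintype.card_fin, nsmul_eq_mul] at h
  have hM' : (0 : ℝ) < M := by positivity
  rw [inv_mul_le_iff₀ hM']
  exact h

lemma mixLaw_eq_withDensity {v : ℝ≥0} (hv : v ≠ 0) (α : Fin M → ι → ℝ) :
    mixLaw v α = volume.withDensity fun x => ENNReal.ofReal (mixDensity v α x) := by
  have hm := measurable_gaussDensity (ι := ι) v
  have hm' := measurable_mixDensity v α
  refine Measure.ext_of_lintegral _ fun φ hφ => ?_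
  rw [mixLaw, lintegral_uniformMixture, lintegral_withDensity_eq_lintegral_mul _ (by fun_prop) hφ]
  have h : ∀ x, ENNReal.ofReal (mixDensity v α x) =
      (M : ℝ≥0∞)⁻¹ * ∑ w, ENNReal.ofReal (gaussDensity v (x - α w)) := by
    intro x
    rcases Nat.eq_zero_or_pos M with rfl | hM
    · simp [mixDensity]
    · rw [mixDensity, ENNReal.ofReal_mul (by positivity),
        ENNReal.ofReal_sum_of_nonneg fun w _ => (gaussDensity_pos hv _).le,
        ENNReal.ofReal_inv_of_pos (by positivity), ENNReal.ofReal_natCast]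
  simp only [Pi.mul_apply, h, mul_assoc, Finset.sum_mul]
  rw [lintegral_const_mul _ (by fun_prop), lintegral_finsetSum _ (by fun_prop)]
  congr 1
  refine Finset.sum_congr rfl fun w _ => ?_
  rw [lintegral_map hφ (by fun_prop), gaussPi_eq_withDensity hv,
    lintegral_withDensity_eq_lintegral_mul _ (by fun_prop) (by fun_prop),
    ← lintegral_sub_right_eq_self _ (α w)]
  simp

/-- The log-density of a Gaussian mixture is integrable under each of its components. -/
lemma integrable_log_mixDensity {v : ℝ≥0} (hv : v ≠ 0) (hM : M ≠ 0) (α : Fin M → ι → ℝ)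
    (w : Fin M) : Integrable (fun u => Real.log (mixDensity v α (α w + u))) (gaussPi ι v) := by
  have hm := measurable_mixDensity v α
  set K := Real.log ((Real.sqrt (2 * Real.pi * v))⁻¹ ^ Fintype.card ι)
  have hlow : Integrable (fun u : ι → ℝ => -Real.log M + Real.log (gaussDensity v u))
      (gaussPi ι v) := by
    simp_rw [log_gaussDensity hv]
    exact (integrable_const _).add
      ((integrable_const _).sub ((integrable_sum_sq_gaussPi v).div_const _))
  refine Integrable.mono' ((integrable_const |K|).add hlow.abs) ?_ (ae_of_all _ fun u => ?_)
  · exact (Real.measurable_log.comp (by fun_prop)).aestronglyMeasurable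
  · have h1 : Real.log (mixDensity v α (α w + u)) ≤ K :=
      Real.log_le_log (mixDensity_pos hv hM α _) (mixDensity_le v hM α _)
    have hg := gaussDensity_pos hv u
    have h2 : -Real.log M + Real.log (gaussDensity v u) ≤
        Real.log (mixDensity v α (α w + u)) := by
      have h3 := le_mixDensity hv α w (α w + u)
      rw [add_sub_cancel_left] at h3
      have hM' : (0 : ℝ) < M := by positivity
      refine le_trans (le_of_eq ?_) (Real.log_le_log (by positivity) h3)
      rw [Real.log_mul (by positivity) hg.ne', Real.log_inv]
    rw [Real.norm_eq_abs, abs_le]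
    simp only [Pi.add_apply]
    constructor
    · have := neg_abs_le (-Real.log M + Real.log (gaussDensity v u))
      linarith [abs_nonneg K]
    · have := le_abs_self K
      linarith [abs_nonneg (-Real.log M + Real.log (gaussDensity v u))]

/-- The negative differential entropy of `mixLaw v α`: the mean of the log-density, written as the
average over the components of the mixture. -/
def negEntropy (v : ℝ≥0) (α : Fin M → ι → ℝ) : ℝ :=
  (M : ℝ)⁻¹ * ∑ w, ∫ u, Real.log (mixDensity v α (α w + u)) ∂(gaussPi ι v)

lemma prod_mixLaw (μ : Measure (ι → ℝ)) [SFinite μ] (v : ℝ≥0) (α : Fin M → ι → ℝ)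
    [SFinite (mixLaw v α)] :
    μ.prod (mixLaw v α) =
      uniformMixture fun w => (μ.prod (gaussPi ι v)).map fun p => (p.1, α w + p.2) := by
  refine Measure.ext_of_lintegral _ fun φ hφ => ?_
  rw [lintegral_prod _ hφ.aemeasurable, lintegral_uniformMixture]
  simp_rw [mixLaw, lintegral_uniformMixture]
  have h1 : ∀ (x : ι → ℝ) (w : Fin M),
      ∫⁻ y, φ (x, y) ∂((gaussPi ι v).map fun u => α w + u) =
        ∫⁻ u, φ (x, α w + u) ∂(gaussPi ι v) :=
    fun x w => lintegral_map (by fun_prop) (by fun_prop)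
  simp_rw [h1]
  have h2 : ∀ w : Fin M, Measurable fun x => ∫⁻ u, φ (x, α w + u) ∂(gaussPi ι v) := fun w =>
    Measurable.lintegral_prod_right' (f := fun p : (ι → ℝ) × (ι → ℝ) => φ (p.1, α w + p.2))
      (by fun_prop)
  rw [lintegral_const_mul _ (by fun_prop), lintegral_finsetSum _ (fun w _ => h2 w)]
  congr 1
  refine Finset.sum_congr rfl fun w _ => ?_
  rw [lintegral_map hφ (by fun_prop), lintegral_prod _ (by fun_prop)]

end GaussianMixture

section GenieBound

variable {ι : Type*} [Fintype ι]

lemma lintegral_ofReal_gaussDensity {v : ℝ≥0} (hv : v ≠ 0) :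
    ∫⁻ x : ι → ℝ, ENNReal.ofReal (gaussDensity v x) = 1 := by
  have h := measure_univ (μ := gaussPi ι v)
  rwa [gaussPi_eq_withDensity hv, withDensity_apply _ MeasurableSet.univ,
    Measure.restrict_univ] at h

lemma lintegral_ofReal_mixDensity {M : ℕ} (hM : M ≠ 0) {v : ℝ≥0} (hv : v ≠ 0)
    (α : Fin M → ι → ℝ) : ∫⁻ x, ENNReal.ofReal (mixDensity v α x) = 1 := by
  have : IsProbabilityMeasure (mixLaw v α) := by
    have : ∀ w, IsProbabilityMeasure ((gaussPi ι v).map fun u => α w + u) := fun w =>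
      Measure.isProbabilityMeasure_map (by fun_prop)
    exact isProbabilityMeasure_uniformMixture hM _
  have h := measure_univ (μ := mixLaw v α)
  rwa [mixLaw_eq_withDensity hv, withDensity_apply _ MeasurableSet.univ,
    Measure.restrict_univ] at h

lemma integrable_affine_sq (a b : ℝ) (v : ℝ≥0) (i : ι) :
    Integrable (fun p : (ι → ℝ) × (ι → ℝ) => (a + (b * p.1 i + p.2 i)) ^ 2)
        ((gaussPi ι v).prod (gaussPi ι v)) ∧
      ∫ p, (a + (b * p.1 i + p.2 i)) ^ 2 ∂((gaussPi ι v).prod (gaussPi ι v)) =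
        a ^ 2 + (b ^ 2 + 1) * v := by
  set v' : ℝ≥0 := (b ^ 2 + 1).toNNReal * v with hv'
  have hv'c : (v' : ℝ) = (b ^ 2 + 1) * v := by
    rw [hv', NNReal.coe_mul, Real.coe_toNNReal _ (by positivity)]
  have hmap := map_linear_prod_gaussPi (ι := ι) b v v v' (by rw [hv'c]; ring)
  have hmp : MeasurePreserving (fun (p : (ι → ℝ) × (ι → ℝ)) i => b * p.1 i + p.2 i)
      ((gaussPi ι v).prod (gaussPi ι v)) (gaussPi ι v') := ⟨by fun_prop, hmap⟩
  have h0 : Integrable (fun x : ι → ℝ => (a + x i) ^ 2) (gaussPi ι v') := by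
    have : (fun x : ι → ℝ => (a + x i) ^ 2) = fun x => a ^ 2 + 2 * a * x i + x i ^ 2 := by
      ext x; ring
    rw [this]
    exact ((integrable_const _).add ((integrable_eval_gaussPi v' i).const_mul _)).add
      (integrable_eval_sq_gaussPi v' i)
  have h1 : ∫ x : ι → ℝ, (a + x i) ^ 2 ∂(gaussPi ι v') = a ^ 2 + v' := by
    have : (fun x : ι → ℝ => (a + x i) ^ 2) = fun x => (a ^ 2 + 2 * a * x i) + x i ^ 2 := by
      ext x; ring
    rw [this, integral_add (f := fun x : ι → ℝ => a ^ 2 + 2 * a * x i)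
      ((integrable_const _).add ((integrable_eval_gaussPi v' i).const_mul _))
      (integrable_eval_sq_gaussPi v' i),
      integral_add (f := fun _ : ι → ℝ => a ^ 2) (integrable_const _)
        ((integrable_eval_gaussPi v' i).const_mul _), integral_const_mul, integral_eval_gaussPi,
      integral_eval_sq_gaussPi]
    simp
  refine ⟨hmp.integrable_comp_of_integrable h0, ?_⟩
  have hm : Measurable fun x : ι → ℝ => (a + x i) ^ 2 := by fun_prop
  rw [← hv'c, ← h1, ← hmap, integral_map (by fun_prop) hm.aestronglyMeasurable]

lemma avg_sq_add_sub_mean_le {M : ℕ} (hM : M ≠ 0) (a : ℝ) (B : Fin M → ℝ) :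
    (M : ℝ)⁻¹ * ∑ w, (a + B w - (M : ℝ)⁻¹ * ∑ w, B w) ^ 2 ≤
      a ^ 2 + (M : ℝ)⁻¹ * ∑ w, B w ^ 2 := by
  set m := (M : ℝ)⁻¹ * ∑ w, B w with hm
  have hM' : (M : ℝ) ≠ 0 := by exact_mod_cast hM
  have hS : ∑ w, B w = M * m := by rw [hm]; field_simp
  have h : ∑ w, (a + B w - m) ^ 2 = M * (a - m) ^ 2 + 2 * (a - m) * (M * m) + ∑ w, B w ^ 2 := by
    have : ∀ w, (a + B w - m) ^ 2 = (a - m) ^ 2 + 2 * (a - m) * B w + B w ^ 2 := fun w => by ring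
    simp_rw [this, Finset.sum_add_distrib, ← Finset.mul_sum, hS]
    simp
  rw [h, mul_add]
  have : (M : ℝ)⁻¹ * (M * (a - m) ^ 2 + 2 * (a - m) * (M * m)) = a ^ 2 - m ^ 2 := by
    field_simp; ring
  rw [this]
  nlinarith [sq_nonneg m]

end GenieBound

/-! ### Change of measure for the genie-aided receiver -/

section GenieBound

variable {ι : Type*} [Fintype ι] {M M' : ℕ}

/-- The integrand of the genie bound: the logarithm of the tilted ratio between the auxiliary
density of the received vector and the side information and their true density, given that the
message `w` was sent. Here `u` is the noise of the side information, and `t` is the sum of the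
interference and of the part of the receiver noise that is independent of `u`. -/
def genieExponent (v₀ v : ℝ≥0) (δ α : Fin M → ι → ℝ) (α' : Fin M' → ι → ℝ)
    (dec : (ι → ℝ) → Fin M) (r l : ℝ) (κ : ι → ℝ) (w : Fin M) (p : (ι → ℝ) × (ι → ℝ)) : ℝ :=
  ({y | dec y = w}.indicator (fun _ => Real.log M) (δ w + r • p.1 + p.2) - Real.log 2)
    - Real.log (gaussDensity v₀ p.1) - Real.log (mixDensity v₀ α' p.2)
    + Real.log (mixDensity v₀ α (α w + p.1))
    + Real.log (gaussDensity v (δ w + r • p.1 + p.2 - l • (α w + p.1) - κ))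

lemma measurable_genieExponent (v₀ v : ℝ≥0) (δ α : Fin M → ι → ℝ) (α' : Fin M' → ι → ℝ)
    {dec : (ι → ℝ) → Fin M} (hdec : Measurable dec) (r l : ℝ) (κ : ι → ℝ) (w : Fin M) :
    Measurable (genieExponent v₀ v δ α α' dec r l κ w) := by
  have h1 := measurable_gaussDensity (ι := ι) v₀
  have h2 := measurable_gaussDensity (ι := ι) v
  have h3 := measurable_mixDensity v₀ α
  have h4 := measurable_mixDensity v₀ α'
  have h5 : Measurable ({y | dec y = w}.indicator (fun _ => Real.log M)) :=
    measurable_const.indicator (hdec (measurableSet_singleton w))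
  have h6 := Real.measurable_log
  unfold genieExponent
  fun_prop

/-- In the coordinates of side information `s` and received vector `y`, reached by a translation,
the true density cancels and the tilted auxiliary density remains. -/
lemma lintegral_exp_genieExponent {v₀ v : ℝ≥0} (hv₀ : v₀ ≠ 0) (hv : v ≠ 0) (hM : M ≠ 0)
    (hM' : M' ≠ 0) (δ α : Fin M → ι → ℝ) (α' : Fin M' → ι → ℝ)
    {dec : (ι → ℝ) → Fin M} (hdec : Measurable dec) (r l : ℝ) (κ : ι → ℝ) (w : Fin M) :
    ∫⁻ p, ENNReal.ofReal (Real.exp (genieExponent v₀ v δ α α' dec r l κ w p))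
        ∂((gaussPi ι v₀).prod (mixLaw v₀ α')) =
      ∫⁻ s : ι → ℝ, ∫⁻ y : ι → ℝ, ENNReal.ofReal (mixDensity v₀ α s) *
        (ENNReal.ofReal (gaussDensity v (y - l • s - κ)) *
          ENNReal.ofReal (Real.exp ({y | dec y = w}.indicator (fun _ => Real.log M) y) / 2)) := by
  have hF := measurable_genieExponent v₀ v δ α α' hdec r l κ w
  have h1 := measurable_gaussDensity (ι := ι) v₀
  have h2 := measurable_gaussDensity (ι := ι) v
  have h3 := measurable_mixDensity v₀ α
  have h4 := measurable_mixDensity v₀ α'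
  have h5 : Measurable ({y | dec y = w}.indicator (fun _ => Real.log M)) :=
    measurable_const.indicator (hdec (measurableSet_singleton w))
  rw [mixLaw_eq_withDensity hv₀, gaussPi_eq_withDensity hv₀, prod_withDensity (by fun_prop)
    (by fun_prop), lintegral_withDensity_eq_lintegral_mul _ (by fun_prop) (by fun_prop)]
  set G : (ι → ℝ) → (ι → ℝ) → ℝ≥0∞ := fun s y => ENNReal.ofReal (mixDensity v₀ α s) *
        (ENNReal.ofReal (gaussDensity v (y - l • s - κ)) *
          ENNReal.ofReal (Real.exp ({y | dec y = w}.indicator (fun _ => Real.log M) y) / 2))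
    with hG
  have hGm : Measurable fun p : (ι → ℝ) × (ι → ℝ) => G (α w + p.1) (δ w + r • p.1 + p.2) := by
    simp only [hG]; fun_prop
  have hpt : ∀ p : (ι → ℝ) × (ι → ℝ), (ENNReal.ofReal (gaussDensity v₀ p.1) *
      ENNReal.ofReal (mixDensity v₀ α' p.2)) *
      ENNReal.ofReal (Real.exp (genieExponent v₀ v δ α α' dec r l κ w p)) =
      G (α w + p.1) (δ w + r • p.1 + p.2) := by
    intro p
    have e1 := gaussDensity_pos hv₀ p.1
    have e2 := mixDensity_pos hv₀ hM' α' p.2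
    have e3 := mixDensity_pos hv₀ hM α (α w + p.1)
    have e4 := gaussDensity_pos hv (δ w + r • p.1 + p.2 - l • (α w + p.1) - κ)
    simp only [hG]
    rw [← ENNReal.ofReal_mul e1.le, ← ENNReal.ofReal_mul (by positivity),
      ← ENNReal.ofReal_mul e4.le, ← ENNReal.ofReal_mul e3.le]
    congr 1
    rw [genieExponent, Real.exp_add, Real.exp_add, Real.exp_sub, Real.exp_sub, Real.exp_sub,
      Real.exp_log e1, Real.exp_log e2, Real.exp_log e3, Real.exp_log e4,
      Real.exp_log (by norm_num)]
    field_simp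
  simp only [Pi.mul_apply, hpt]
  rw [lintegral_prod _ hGm.aemeasurable]
  have hshift : ∀ u : ι → ℝ, ∫⁻ t, G (α w + u) (δ w + r • u + t) = ∫⁻ y, G (α w + u) y := fun u =>
    lintegral_add_left_eq_self (G (α w + u)) _
  simp only [hshift]
  exact lintegral_add_left_eq_self (fun s => ∫⁻ y, G s y) (α w)

/-- Summed over the messages, the tilt `M` for the decoded message and `1` for the others gives at
most `2 M`, and the auxiliary density has total mass one. -/
lemma sum_lintegral_exp_genieExponent_le {v₀ v : ℝ≥0} (hv₀ : v₀ ≠ 0) (hv : v ≠ 0) (hM : M ≠ 0)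
    (hM' : M' ≠ 0) (δ α : Fin M → ι → ℝ) (α' : Fin M' → ι → ℝ)
    {dec : (ι → ℝ) → Fin M} (hdec : Measurable dec) (r l : ℝ) (κ : ι → ℝ) :
    ∑ w, ∫⁻ p, ENNReal.ofReal (Real.exp (genieExponent v₀ v δ α α' dec r l κ w p))
        ∂((gaussPi ι v₀).prod (mixLaw v₀ α')) ≤ M := by
  have h2 := measurable_gaussDensity (ι := ι) v
  have h3 := measurable_mixDensity v₀ α
  have h5 : ∀ w, Measurable ({y | dec y = w}.indicator (fun _ => Real.log M)) := fun w =>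
    measurable_const.indicator (hdec (measurableSet_singleton w))
  simp_rw [lintegral_exp_genieExponent hv₀ hv hM hM' δ α α' hdec r l κ]
  have hsum : ∀ y, ∑ w, ENNReal.ofReal
      (Real.exp ({y | dec y = w}.indicator (fun _ => Real.log M) y) / 2) ≤ M := by
    intro y
    rw [← ENNReal.ofReal_sum_of_nonneg fun w _ => by positivity]
    refine ENNReal.ofReal_le_of_le_toReal ?_
    rw [ENNReal.toReal_natCast, ← Finset.sum_div]
    have hM1 : (1 : ℝ) ≤ M := by exact_mod_cast Nat.one_le_iff_ne_zero.2 hM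
    have h : ∀ w, Real.exp ({y | dec y = w}.indicator (fun _ => Real.log M) y) ≤
        1 + if dec y = w then (M : ℝ) else 0 := by
      intro w
      by_cases hw : dec y = w
      · rw [Set.indicator_of_mem (by exact hw), Real.exp_log (by linarith), if_pos hw]
        linarith
      · rw [Set.indicator_of_notMem (by exact hw), if_neg hw]
        simp
    have := Finset.sum_le_sum fun w (_ : w ∈ Finset.univ) => h w
    rw [Finset.sum_add_distrib] at this
    simp only [Finset.sum_const, Finset.card_univ, Fintype.card_fin, nsmul_eq_mul, mul_one,
      Finset.sum_ite_eq, Finset.mem_univ, if_true] at this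
    linarith
  have hjoint : ∀ w, Measurable fun p : (ι → ℝ) × (ι → ℝ) => ENNReal.ofReal (mixDensity v₀ α p.1) *
        (ENNReal.ofReal (gaussDensity v (p.2 - l • p.1 - κ)) *
          ENNReal.ofReal
            (Real.exp ({y | dec y = w}.indicator (fun _ => Real.log M) p.2) / 2)) := by
    intro w
    have := h5 w
    fun_prop
  rw [← lintegral_finsetSum _ fun w _ => (hjoint w).lintegral_prod_right']
  have hslice : ∀ s : ι → ℝ, ∑ w, ∫⁻ y : ι → ℝ, ENNReal.ofReal (mixDensity v₀ α s) *
        (ENNReal.ofReal (gaussDensity v (y - l • s - κ)) *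
          ENNReal.ofReal (Real.exp ({y | dec y = w}.indicator (fun _ => Real.log M) y) / 2)) ≤
      ENNReal.ofReal (mixDensity v₀ α s) * M := by
    intro s
    rw [← lintegral_finsetSum _ fun w _ => by have := h5 w; fun_prop]
    simp_rw [← Finset.mul_sum]
    rw [lintegral_const_mul _ (by fun_prop)]
    gcongr
    refine (lintegral_mono fun y => mul_le_mul_right (hsum y) _).trans_eq ?_
    rw [lintegral_mul_const _ (by fun_prop)]
    have : ∫⁻ y : ι → ℝ, ENNReal.ofReal (gaussDensity v (y - l • s - κ)) = 1 := by
      simp_rw [sub_sub]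
      rw [lintegral_sub_right_eq_self (fun y => ENNReal.ofReal (gaussDensity v y)),
        lintegral_ofReal_gaussDensity hv]
    rw [this, one_mul]
  refine (lintegral_mono hslice).trans_eq ?_
  rw [lintegral_mul_const _ (by fun_prop), lintegral_ofReal_mixDensity hM hv₀, one_mul]

end GenieBound

/-! ### Genie bound for one user -/

section GenieBound

variable {ι : Type*} [Fintype ι] {M M' : ℕ}

lemma integral_log_gaussDensity {v : ℝ≥0} (hv : v ≠ 0) :
    ∫ u : ι → ℝ, Real.log (gaussDensity v u) ∂(gaussPi ι v) =
      -(Fintype.card ι / 2 * Real.log (2 * Real.pi * v)) - Fintype.card ι / 2 := by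
  have hv' : (0 : ℝ) < v := by positivity
  simp_rw [log_gaussDensity hv]
  rw [integral_sub (integrable_const _) ((integrable_sum_sq_gaussPi v).div_const _), integral_div,
    integral_finsetSum _ fun i _ => integrable_eval_sq_gaussPi v i]
  simp_rw [integral_eval_sq_gaussPi]
  simp
  field_simp

/-- The expected quadratic term of the auxiliary Gaussian density. -/
lemma integral_log_gaussDensity_residual {v₀ v : ℝ≥0} (hv : v ≠ 0) (a b : ι → ℝ) (e κ : ι → ℝ)
    (r l : ℝ) :
    Integrable (fun p : (ι → ℝ) × (ι → ℝ) =>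
        Real.log (gaussDensity v (a + r • p.1 + (e + p.2) - l • (b + p.1) - κ)))
      ((gaussPi ι v₀).prod (gaussPi ι v₀)) ∧
    ∫ p : (ι → ℝ) × (ι → ℝ),
        Real.log (gaussDensity v (a + r • p.1 + (e + p.2) - l • (b + p.1) - κ))
      ∂((gaussPi ι v₀).prod (gaussPi ι v₀)) =
      -(Fintype.card ι / 2 * Real.log (2 * Real.pi * v)) -
        (∑ i, (a i - l * b i + e i - κ i) ^ 2 + Fintype.card ι * (((r - l) ^ 2 + 1) * v₀)) /
          (2 * v) := by
  have hterm : ∀ (p : (ι → ℝ) × (ι → ℝ)) (i : ι),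
      (a + r • p.1 + (e + p.2) - l • (b + p.1) - κ) i =
        (a i - l * b i + e i - κ i) + ((r - l) * p.1 i + p.2 i) := by
    intro p i
    simp only [Pi.sub_apply, Pi.add_apply, Pi.smul_apply, smul_eq_mul]
    ring
  have hi := fun i => integrable_affine_sq (ι := ι) (a i - l * b i + e i - κ i) (r - l) v₀ i
  have hsum : Integrable (fun p : (ι → ℝ) × (ι → ℝ) =>
      ∑ i, ((a i - l * b i + e i - κ i) + ((r - l) * p.1 i + p.2 i)) ^ 2)
      ((gaussPi ι v₀).prod (gaussPi ι v₀)) := integrable_finsetSum _ fun i _ => (hi i).1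
  simp_rw [log_gaussDensity hv, hterm]
  refine ⟨(integrable_const _).sub (hsum.div_const _), ?_⟩
  rw [integral_sub (integrable_const _) (hsum.div_const _), integral_div,
    integral_finsetSum _ fun i _ => (hi i).1]
  simp_rw [(hi _).2, Finset.sum_add_distrib]
  simp

/-- The mean of the genie exponent is at most zero, by `x + 1 ≤ exp x`. This is the data processing
inequality for the event that the message is decoded correctly. -/
lemma sum_integral_genieExponent_nonpos {v₀ v : ℝ≥0} (hv₀ : v₀ ≠ 0) (hv : v ≠ 0) (hM : M ≠ 0)
    (hM' : M' ≠ 0) (δ α : Fin M → ι → ℝ) (α' : Fin M' → ι → ℝ)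
    {dec : (ι → ℝ) → Fin M} (hdec : Measurable dec) (r l : ℝ) (κ : ι → ℝ)
    (hint : ∀ w, Integrable (genieExponent v₀ v δ α α' dec r l κ w)
      ((gaussPi ι v₀).prod (mixLaw v₀ α'))) :
    ∑ w, ∫ p, genieExponent v₀ v δ α α' dec r l κ w p
      ∂((gaussPi ι v₀).prod (mixLaw v₀ α')) ≤ 0 := by
  have : ∀ w, IsProbabilityMeasure ((gaussPi ι v₀).map fun u => α' w + u) := fun w =>
      Measure.isProbabilityMeasure_map (by fun_prop)
  have : IsProbabilityMeasure (mixLaw v₀ α') := isProbabilityMeasure_uniformMixture hM' _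
  have hle := sum_lintegral_exp_genieExponent_le hv₀ hv hM hM' δ α α' hdec r l κ
  have hfin : ∀ w, ∫⁻ p, ENNReal.ofReal (Real.exp (genieExponent v₀ v δ α α' dec r l κ w p))
        ∂((gaussPi ι v₀).prod (mixLaw v₀ α')) ≠ ∞ := by
    intro w
    refine ne_top_of_le_ne_top (ENNReal.natCast_ne_top M) (le_trans ?_ hle)
    exact Finset.single_le_sum (f := fun w => ∫⁻ p, ENNReal.ofReal
      (Real.exp (genieExponent v₀ v δ α α' dec r l κ w p))
        ∂((gaussPi ι v₀).prod (mixLaw v₀ α'))) (fun _ _ => zero_le) (Finset.mem_univ w)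
  have hm : ∀ w, AEStronglyMeasurable (fun p => Real.exp (genieExponent v₀ v δ α α' dec r l κ w p))
      ((gaussPi ι v₀).prod (mixLaw v₀ α')) := fun w =>
    (Real.measurable_exp.comp
      (measurable_genieExponent v₀ v δ α α' hdec r l κ w)).aestronglyMeasurable
  have hone : ∀ w, ∫ p, genieExponent v₀ v δ α α' dec r l κ w p
      ∂((gaussPi ι v₀).prod (mixLaw v₀ α')) ≤
      (∫⁻ p, ENNReal.ofReal (Real.exp (genieExponent v₀ v δ α α' dec r l κ w p))
        ∂((gaussPi ι v₀).prod (mixLaw v₀ α'))).toReal - 1 := by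
    intro w
    have hexp : Integrable (fun p => Real.exp (genieExponent v₀ v δ α α' dec r l κ w p))
        ((gaussPi ι v₀).prod (mixLaw v₀ α')) := by
      refine ⟨hm w, ?_⟩
      rw [hasFiniteIntegral_iff_ofReal (ae_of_all _ fun _ => (Real.exp_pos _).le)]
      exact lt_top_iff_ne_top.2 (hfin w)
    rw [← integral_eq_lintegral_of_nonneg_ae (ae_of_all _ fun _ => (Real.exp_pos _).le) (hm w)]
    have h1 : ∫ p, (genieExponent v₀ v δ α α' dec r l κ w p + 1)
        ∂((gaussPi ι v₀).prod (mixLaw v₀ α')) ≤ _ :=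
      integral_mono ((hint w).add (integrable_const 1)) hexp fun p => Real.add_one_le_exp _
    rw [integral_add (hint w) (integrable_const 1)] at h1
    simp only [integral_const, probReal_univ, smul_eq_mul, mul_one] at h1
    linarith
  refine (Finset.sum_le_sum fun w _ => hone w).trans ?_
  rw [Finset.sum_sub_distrib, ← ENNReal.toReal_sum fun w _ => hfin w]
  have := ENNReal.toReal_mono (ENNReal.natCast_ne_top M) hle
  rw [ENNReal.toReal_natCast] at this
  simpa using this

lemma average_bound (hM : M ≠ 0) (hM' : M' ≠ 0) {A Q : Fin M → Fin M' → ℝ} {B : Fin M → ℝ}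
    {B' : Fin M' → ℝ} {L a g k N V : ℝ}
    (h : ∑ w, (M' : ℝ)⁻¹ * ∑ w', (A w w' * L - a - g - B' w' + B w + (k - (Q w w' + N) / V)) ≤ 0) :
    ((M : ℝ)⁻¹ * ∑ w, (M' : ℝ)⁻¹ * ∑ w', A w w') * L - a - g - (M' : ℝ)⁻¹ * ∑ w', B' w' +
      (M : ℝ)⁻¹ * ∑ w, B w + (k - ((M : ℝ)⁻¹ * (∑ w, (M' : ℝ)⁻¹ * ∑ w', Q w w') + N) / V) ≤ 0 := by
  have hMr : (M : ℝ) ≠ 0 := by exact_mod_cast hM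
  have hMr' : (M' : ℝ) ≠ 0 := by exact_mod_cast hM'
  refine le_trans (le_of_eq ?_) (mul_nonpos_of_nonneg_of_nonpos (a := (M : ℝ)⁻¹) (by positivity) h)
  simp only [Finset.sum_add_distrib, Finset.sum_sub_distrib, Finset.sum_const, Finset.card_univ,
    Fintype.card_fin, nsmul_eq_mul, ← Finset.sum_div, ← Finset.sum_mul, ← Finset.mul_sum]
  generalize ∑ w, ∑ w', A w w' = SA
  generalize ∑ w, ∑ w', Q w w' = SQ
  generalize ∑ w, B w = SB
  generalize ∑ w', B' w' = SB'
  simp only [div_eq_mul_inv]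
  field_simp

/-- The genie bound for one user, in terms of the probability of correct decoding. The side
information of this user and the interference plus conditional noise of the other user have the
same law, so the `negEntropy` terms cancel when the bounds of both users are added. -/
lemma genie_bound {v₀ v : ℝ≥0} (hv₀ : v₀ ≠ 0) (hv : v ≠ 0) (hM : M ≠ 0)
    (hM' : M' ≠ 0) (δ α : Fin M → ι → ℝ) (α' : Fin M' → ι → ℝ)
    {dec : (ι → ℝ) → Fin M} (hdec : Measurable dec) (r l : ℝ) (κ : ι → ℝ) :
    ((M : ℝ)⁻¹ * ∑ w, (M' : ℝ)⁻¹ * ∑ w', ((gaussPi ι v₀).prod (gaussPi ι v₀)).real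
        {p | dec (δ w + r • p.1 + (α' w' + p.2)) = w}) * Real.log M - Real.log 2 ≤
      Fintype.card ι / 2 * Real.log (2 * Real.pi * v) -
        Fintype.card ι / 2 * Real.log (2 * Real.pi * v₀) - Fintype.card ι / 2 +
        negEntropy v₀ α' - negEntropy v₀ α +
        ((M : ℝ)⁻¹ * (∑ w, (M' : ℝ)⁻¹ * ∑ w', ∑ i, (δ w i - l * α w i + α' w' i - κ i) ^ 2) +
          Fintype.card ι * (((r - l) ^ 2 + 1) * v₀)) / (2 * v) := by
  have hcomp : ∀ w, IsProbabilityMeasure ((gaussPi ι v₀).map fun u => α' w + u) := fun w =>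
      Measure.isProbabilityMeasure_map (by fun_prop)
  have hprob : IsProbabilityMeasure (mixLaw v₀ α') := isProbabilityMeasure_uniformMixture hM' _
  set γγ := (gaussPi ι v₀).prod (gaussPi ι v₀) with hγγ
  have hMr : (M : ℝ) ≠ 0 := by exact_mod_cast hM
  have hMr' : (M' : ℝ) ≠ 0 := by exact_mod_cast hM'
  -- Integrability and value of each term, for fixed messages of both users.
  have hset : ∀ w w', MeasurableSet {p : (ι → ℝ) × (ι → ℝ) |
      dec (δ w + r • p.1 + (α' w' + p.2)) = w} := fun w w' =>
    measurableSet_eq_fun (hdec.comp (by fun_prop)) measurable_const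
  have i1 : ∀ w w', Integrable (fun p : (ι → ℝ) × (ι → ℝ) =>
      {y | dec y = w}.indicator (fun _ => Real.log M) (δ w + r • p.1 + (α' w' + p.2))) γγ ∧
      ∫ p, {y | dec y = w}.indicator (fun _ => Real.log M) (δ w + r • p.1 + (α' w' + p.2)) ∂γγ =
        γγ.real {p | dec (δ w + r • p.1 + (α' w' + p.2)) = w} * Real.log M := by
    intro w w'
    have h : (fun p : (ι → ℝ) × (ι → ℝ) =>
        {y | dec y = w}.indicator (fun _ => Real.log M) (δ w + r • p.1 + (α' w' + p.2))) =
        {p : (ι → ℝ) × (ι → ℝ) | dec (δ w + r • p.1 + (α' w' + p.2)) = w}.indicator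
          fun _ => Real.log M := rfl
    rw [h]
    exact ⟨(integrable_const _).indicator (hset w w'), integral_indicator_const _ (hset w w')⟩
  have i2 : Integrable (fun p : (ι → ℝ) × (ι → ℝ) => Real.log (gaussDensity v₀ p.1)) γγ := by
    have : Integrable (fun u : ι → ℝ => Real.log (gaussDensity v₀ u)) (gaussPi ι v₀) := by
      simp_rw [log_gaussDensity hv₀]
      exact (integrable_const _).sub ((integrable_sum_sq_gaussPi v₀).div_const _)
    exact this.comp_fst _
  have e2 : ∫ p : (ι → ℝ) × (ι → ℝ), Real.log (gaussDensity v₀ p.1) ∂γγ =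
      -(Fintype.card ι / 2 * Real.log (2 * Real.pi * v₀)) - Fintype.card ι / 2 := by
    rw [hγγ, integral_fun_fst (fun u => Real.log (gaussDensity v₀ u)), probReal_univ, one_smul,
      integral_log_gaussDensity hv₀]
  have i3 : ∀ w', Integrable (fun p : (ι → ℝ) × (ι → ℝ) =>
      Real.log (mixDensity v₀ α' (α' w' + p.2))) γγ := fun w' =>
    (integrable_log_mixDensity hv₀ hM' α' w').comp_snd _
  have e3 : ∀ w', ∫ p : (ι → ℝ) × (ι → ℝ), Real.log (mixDensity v₀ α' (α' w' + p.2)) ∂γγ =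
      ∫ u, Real.log (mixDensity v₀ α' (α' w' + u)) ∂(gaussPi ι v₀) := fun w' => by
    rw [hγγ, integral_fun_snd (fun u => Real.log (mixDensity v₀ α' (α' w' + u))), probReal_univ,
      one_smul]
  have i4 : ∀ w, Integrable (fun p : (ι → ℝ) × (ι → ℝ) =>
      Real.log (mixDensity v₀ α (α w + p.1))) γγ := fun w =>
    (integrable_log_mixDensity hv₀ hM α w).comp_fst _
  have e4 : ∀ w, ∫ p : (ι → ℝ) × (ι → ℝ), Real.log (mixDensity v₀ α (α w + p.1)) ∂γγ =
      ∫ u, Real.log (mixDensity v₀ α (α w + u)) ∂(gaussPi ι v₀) := fun w => by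
    rw [hγγ, integral_fun_fst (fun u => Real.log (mixDensity v₀ α (α w + u))), probReal_univ,
      one_smul]
  have i5 := fun w w' =>
    integral_log_gaussDensity_residual (v₀ := v₀) hv (δ w) (α w) (α' w') κ r l
  have iF : ∀ w w', Integrable (fun p : (ι → ℝ) × (ι → ℝ) =>
      genieExponent v₀ v δ α α' dec r l κ w (p.1, α' w' + p.2)) γγ := fun w w' =>
    ((((((i1 w w').1).sub (integrable_const _)).sub i2).sub (i3 w')).add (i4 w)).add (i5 w w').1
  have eF : ∀ w w', ∫ p : (ι → ℝ) × (ι → ℝ),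
      genieExponent v₀ v δ α α' dec r l κ w (p.1, α' w' + p.2) ∂γγ =
      γγ.real {p | dec (δ w + r • p.1 + (α' w' + p.2)) = w} * Real.log M - Real.log 2
      - (-(Fintype.card ι / 2 * Real.log (2 * Real.pi * v₀)) - Fintype.card ι / 2)
      - ∫ u, Real.log (mixDensity v₀ α' (α' w' + u)) ∂(gaussPi ι v₀)
      + ∫ u, Real.log (mixDensity v₀ α (α w + u)) ∂(gaussPi ι v₀)
      + (-(Fintype.card ι / 2 * Real.log (2 * Real.pi * v)) -
        (∑ i, (δ w i - l * α w i + α' w' i - κ i) ^ 2 +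
          Fintype.card ι * (((r - l) ^ 2 + 1) * v₀)) / (2 * v)) := by
    intro w w'
    have s1 := ((i1 w w').1).sub (integrable_const (Real.log 2))
    have s2 := s1.sub i2
    have s3 := s2.sub (i3 w')
    have s4 := s3.add (i4 w)
    have k5 := integral_add' s4 (i5 w w').1
    have k4 := integral_add' s3 (i4 w)
    have k3 := integral_sub' s2 (i3 w')
    have k2 := integral_sub' s1 i2
    have k1 := integral_sub' ((i1 w w').1) (integrable_const (μ := γγ) (Real.log 2))
    refine k5.trans ?_
    rw [k4, k3, k2, k1, (i1 w w').2, e2, e3 w', e4 w, (i5 w w').2]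
    simp
  have hmF := measurable_genieExponent v₀ v δ α α' hdec r l κ
  have iμ : ∀ w w', Integrable (genieExponent v₀ v δ α α' dec r l κ w)
      (γγ.map fun p => (p.1, α' w' + p.2)) := fun w w' => by
    rw [integrable_map_measure (hmF w).aestronglyMeasurable (by fun_prop)]
    exact iF w w'
  have hmain := sum_integral_genieExponent_nonpos hv₀ hv hM hM' δ α α' hdec r l κ (fun w => by
    rw [prod_mixLaw]
    exact integrable_uniformMixture hM' (iμ w))
  have hmap : ∀ w w', ∫ p, genieExponent v₀ v δ α α' dec r l κ w p
      ∂(γγ.map fun p => (p.1, α' w' + p.2)) =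
      γγ.real {p | dec (δ w + r • p.1 + (α' w' + p.2)) = w} * Real.log M - Real.log 2
      - (-(Fintype.card ι / 2 * Real.log (2 * Real.pi * v₀)) - Fintype.card ι / 2)
      - ∫ u, Real.log (mixDensity v₀ α' (α' w' + u)) ∂(gaussPi ι v₀)
      + ∫ u, Real.log (mixDensity v₀ α (α w + u)) ∂(gaussPi ι v₀)
      + (-(Fintype.card ι / 2 * Real.log (2 * Real.pi * v)) -
        (∑ i, (δ w i - l * α w i + α' w' i - κ i) ^ 2 +
          Fintype.card ι * (((r - l) ^ 2 + 1) * v₀)) / (2 * v)) := fun w w' =>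
    (integral_map (by fun_prop) (hmF w).aestronglyMeasurable).trans (eF w w')
  have hval : ∀ w, ∫ p, genieExponent v₀ v δ α α' dec r l κ w p
      ∂((gaussPi ι v₀).prod (mixLaw v₀ α')) = (M' : ℝ)⁻¹ * ∑ w', ∫ p,
        genieExponent v₀ v δ α α' dec r l κ w p ∂(γγ.map fun p => (p.1, α' w' + p.2)) := fun w => by
    rw [prod_mixLaw, integral_uniformMixture (iμ w)]
  simp_rw [hval, hmap] at hmain
  have := average_bound hM hM' hmain
  simp only [negEntropy]
  linarith

end GenieBound

/-! ### Converse -/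

section Converse

/-- Averaging out an independent interference term around its mean costs at most its energy. -/
lemma avg_residual_le {ι : Type*} [Fintype ι] {M M' : ℕ} (hM : M ≠ 0) (hM' : M' ≠ 0)
    (a : Fin M → ι → ℝ) (b : Fin M' → ι → ℝ) :
    (M : ℝ)⁻¹ * (∑ w, (M' : ℝ)⁻¹ * ∑ w', ∑ i,
        (a w i + b w' i - (M' : ℝ)⁻¹ * ∑ w', b w' i) ^ 2) ≤
      (M : ℝ)⁻¹ * (∑ w, ∑ i, a w i ^ 2) + (M' : ℝ)⁻¹ * ∑ w', ∑ i, b w' i ^ 2 := by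
  have hMr : (M : ℝ) ≠ 0 := by exact_mod_cast hM
  have h1 : ∀ w, (M' : ℝ)⁻¹ * ∑ w', ∑ i,
      (a w i + b w' i - (M' : ℝ)⁻¹ * ∑ w', b w' i) ^ 2 ≤
      ∑ i, a w i ^ 2 + (M' : ℝ)⁻¹ * ∑ w', ∑ i, b w' i ^ 2 := by
    intro w
    rw [Finset.sum_comm, Finset.sum_comm (f := fun w' i => b w' i ^ 2), Finset.mul_sum,
      Finset.mul_sum, ← Finset.sum_add_distrib]
    exact Finset.sum_le_sum fun i _ => avg_sq_add_sub_mean_le hM' _ _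
  have h2 := Finset.sum_le_sum fun w (_ : w ∈ Finset.univ) => h1 w
  rw [Finset.sum_add_distrib] at h2
  have h3 := mul_le_mul_of_nonneg_left h2 (by positivity : 0 ≤ (M : ℝ)⁻¹)
  refine h3.trans_eq ?_
  simp
  field_simp

lemma trace_inputCovariance {m n M : ℕ} (enc : Fin M → Fin n → EuclideanSpace ℝ (Fin m)) :
    (inputCovariance enc).trace = (n : ℝ)⁻¹ * ∑ t, (M : ℝ)⁻¹ * ∑ w, ‖enc w t‖ ^ 2 := by
  simp only [inputCovariance, Matrix.trace_smul, Matrix.trace_sum, trace_vecMulVec_self,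
    smul_eq_mul]

lemma sum_norm_sq_le {m n M : ℕ} {P : ℝ} (hn : 0 < n)
    {enc : Fin M → Fin n → EuclideanSpace ℝ (Fin m)}
    (h : inputCovariance enc ∈ covarianceConstraint m P) :
    (M : ℝ)⁻¹ * ∑ w, ∑ t, ‖enc w t‖ ^ 2 ≤ n * P := by
  have h1 := h.2
  have hn' : (0 : ℝ) < n := by exact_mod_cast hn
  rw [trace_inputCovariance, inv_mul_le_iff₀ hn', ← Finset.mul_sum] at h1
  rwa [Finset.sum_comm]

/-- The bound of the estimation error form, lifted to the input space. -/
lemma quadratic_form_le {m : ℕ} {d c : EuclideanSpace ℝ (Fin m)} {θ h l t : ℝ} (hd : ‖d‖ = 1)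
    (hc : ‖c‖ = 1) (hθ : InnerProductGeometry.angle d c = θ) (hsin : 0 < Real.sin θ) (ht : 0 ≤ t)
    (hform : ∀ α β : ℝ, ((Real.cos θ - l * h) * α + Real.sin θ * β) ^ 2 + h ^ 2 * α ^ 2 ≤
      t * (α ^ 2 + β ^ 2)) (x : EuclideanSpace ℝ (Fin m)) :
    (inner ℝ d x - l * (h * inner ℝ c x)) ^ 2 + (h * inner ℝ c x) ^ 2 ≤ t * ‖x‖ ^ 2 := by
  set α := inner ℝ c x with hα
  set D := inner ℝ d x with hD
  set β := (D - Real.cos θ * α) / Real.sin θ with hβ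
  have hβs : Real.sin θ * β = D - Real.cos θ * α := by rw [hβ]; field_simp
  have hbessel : α ^ 2 + β ^ 2 ≤ ‖x‖ ^ 2 := by
    set e := (Real.sin θ)⁻¹ • (d - Real.cos θ • c) with he
    have hdc := inner_eq_cos_angle hd hc hθ
    have hcd : inner ℝ c d = Real.cos θ := by rw [real_inner_comm]; exact hdc
    have hee : ‖e‖ ^ 2 = 1 := by
      rw [he, norm_smul, mul_pow, norm_sub_sq_real, inner_smul_right, norm_smul, mul_pow, hd, hc,
        hdc, Real.norm_eq_abs, Real.norm_eq_abs, sq_abs, sq_abs]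
      field_simp
      nlinarith [Real.sin_sq_add_cos_sq θ]
    have hce : inner ℝ c e = 0 := by
      rw [he, inner_smul_right, inner_sub_right, inner_smul_right, hcd,
        real_inner_self_eq_norm_sq, hc]
      ring
    have hex : inner ℝ e x = β := by
      rw [he, inner_smul_left, inner_sub_left, inner_smul_left, hβ]
      simp only [conj_trivial]
      rw [← hα, ← hD, div_eq_inv_mul]
    clear_value e
    have h1 : ‖x - (α • c + β • e)‖ ^ 2 = ‖x‖ ^ 2 - (α ^ 2 + β ^ 2) := by
      rw [norm_sub_sq_real, norm_add_sq_real, inner_add_right, inner_smul_right, inner_smul_right,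
        inner_smul_left, inner_smul_right, norm_smul, norm_smul, mul_pow, mul_pow, hee, hce, hc,
        real_inner_comm c x, real_inner_comm e x, hex, ← hα, Real.norm_eq_abs, Real.norm_eq_abs,
        sq_abs, sq_abs]
      ring
    nlinarith [sq_nonneg ‖x - (α • c + β • e)‖]
  have h2 := hform α β
  rw [hβs] at h2
  calc (D - l * (h * α)) ^ 2 + (h * α) ^ 2
      = ((Real.cos θ - l * h) * α + (D - Real.cos θ * α)) ^ 2 + h ^ 2 * α ^ 2 := by ring
    _ ≤ t * (α ^ 2 + β ^ 2) := h2
    _ ≤ t * ‖x‖ ^ 2 := mul_le_mul_of_nonneg_left hbessel ht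

/-- The receiver noise is split into the noise of the side information and an independent part. -/
lemma prob_correct_eq {n M : ℕ} {v₀ : ℝ≥0} {r : ℝ} (hr : (r ^ 2 + 1) * v₀ = 1)
    {dec : (Fin n → ℝ) → Fin M} (hdec : Measurable dec) (w : Fin M) (a b : Fin n → ℝ) :
    ((gaussPi (Fin n) v₀).prod (gaussPi (Fin n) v₀)).real
        {p | dec (a + r • p.1 + (b + p.2)) = w} =
      1 - (noise n).real {z | dec (fun t => a t + b t + z t) ≠ w} := by
  have hmap : ((gaussPi (Fin n) v₀).prod (gaussPi (Fin n) v₀)).map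
      (fun p i => r * p.1 i + p.2 i) = noise n :=
    map_linear_prod_gaussPi r v₀ v₀ 1 (by push_cast; linarith)
  have hS : MeasurableSet {z : Fin n → ℝ | dec (fun t => a t + b t + z t) ≠ w} :=
    (measurableSet_eq_fun (hdec.comp (by fun_prop)) measurable_const).compl
  rw [← hmap, map_measureReal_apply (by fun_prop) hS, ← probReal_compl_eq_one_sub
    (hS.preimage (by fun_prop))]
  congr 1
  ext p
  simp only [Set.mem_ofPred_eq, Set.mem_compl_iff, Set.mem_preimage, not_not]
  have : a + r • p.1 + (b + p.2) = fun t => a t + b t + (r * p.1 t + p.2 t) := by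
    ext t; simp only [Pi.add_apply, Pi.smul_apply, smul_eq_mul]; ring
  rw [this]

/-- The one-user bound for a code, with the error probability and the input energy. -/
lemma user_bound {m n M M' : ℕ} (hM : M ≠ 0) (hM' : M' ≠ 0) {v₀ v : ℝ≥0} (hv₀ : v₀ ≠ 0)
    (hv : v ≠ 0) {r : ℝ} (hr : (r ^ 2 + 1) * v₀ = 1) (l : ℝ)
    (d c : EuclideanSpace ℝ (Fin m)) (h : ℝ)
    (enc : Fin M → Fin n → EuclideanSpace ℝ (Fin m))
    (enc' : Fin M' → Fin n → EuclideanSpace ℝ (Fin m))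
    {dec : (Fin n → ℝ) → Fin M} (hdec : Measurable dec) :
    (1 - (M : ℝ)⁻¹ * ∑ w, (M' : ℝ)⁻¹ * ∑ w', (noise n).real
        {z | dec (fun t => received d c h (enc w t) (enc' w' t) (z t)) ≠ w}) * Real.log M
        - Real.log 2 ≤
      n / 2 * Real.log (2 * Real.pi * v) - n / 2 * Real.log (2 * Real.pi * v₀) - n / 2 +
        negEntropy v₀ (fun w t => h * inner ℝ c (enc' w t)) -
        negEntropy v₀ (fun w t => h * inner ℝ c (enc w t)) +
        ((M : ℝ)⁻¹ * (∑ w, ∑ t, (inner ℝ d (enc w t) - l * (h * inner ℝ c (enc w t))) ^ 2) +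
          (M' : ℝ)⁻¹ * (∑ w', ∑ t, (h * inner ℝ c (enc' w' t)) ^ 2) +
          n * (((r - l) ^ 2 + 1) * v₀)) / (2 * v) := by
  have hMr : (M : ℝ) ≠ 0 := by exact_mod_cast hM
  have hMr' : (M' : ℝ) ≠ 0 := by exact_mod_cast hM'
  have hb := genie_bound hv₀ hv hM hM' (fun w t => inner ℝ d (enc w t))
    (fun w t => h * inner ℝ c (enc w t)) (fun w t => h * inner ℝ c (enc' w t)) hdec r l
    (fun t => (M' : ℝ)⁻¹ * ∑ w', h * inner ℝ c (enc' w' t))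
  simp_rw [prob_correct_eq hr hdec] at hb
  have hq := avg_residual_le hM hM' (ι := Fin n)
    (fun w t => inner ℝ d (enc w t) - l * (h * inner ℝ c (enc w t)))
    (fun w t => h * inner ℝ c (enc' w t))
  have havg : (M : ℝ)⁻¹ * ∑ w, (M' : ℝ)⁻¹ * ∑ w', (1 - (noise n).real
      {z | dec (fun t => inner ℝ d (enc w t) + h * inner ℝ c (enc' w' t) + z t) ≠ w}) =
      1 - (M : ℝ)⁻¹ * ∑ w, (M' : ℝ)⁻¹ * ∑ w', (noise n).real
        {z | dec (fun t => received d c h (enc w t) (enc' w' t) (z t)) ≠ w} := by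
    simp only [received, Finset.sum_sub_distrib, mul_sub]
    simp
    field_simp
  rw [havg] at hb
  refine hb.trans ?_
  rw [Fintype.card_fin]
  gcongr

/-- The genie bound on the sum of the code sizes. -/
lemma log_card_add_log_card_le {m n M₁ M₂ : ℕ} (hn : 0 < n) (hM₁ : M₁ ≠ 0) (hM₂ : M₂ ≠ 0)
    (C : Code m n M₁ M₂) {d c : EuclideanSpace ℝ (Fin m)} {θ h P g p l t : ℝ} (hd : ‖d‖ = 1)
    (hc : ‖c‖ = 1) (hθ : InnerProductGeometry.angle d c = θ) (hsin : 0 < Real.sin θ)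
    (hP : 0 ≤ P) (hg : 0 < g) (ht : 0 ≤ t) (hpg : p ^ 2 + g ^ 2 = 1)
    (hform : ∀ α β : ℝ, ((Real.cos θ - l * h) * α + Real.sin θ * β) ^ 2 + h ^ 2 * α ^ 2 ≤
      t * (α ^ 2 + β ^ 2))
    (hC₁ : inputCovariance C.enc₁ ∈ covarianceConstraint m P)
    (hC₂ : inputCovariance C.enc₂ ∈ covarianceConstraint m P) :
    (1 - C.errorProb₁ d c h) * Real.log M₁ + (1 - C.errorProb₂ d c h) * Real.log M₂ -
      2 * Real.log 2 ≤ n * Real.log ((P * t + ((p - l * g) ^ 2 + g ^ 2)) / g ^ 2) := by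
  set V := P * t + ((p - l * g) ^ 2 + g ^ 2) with hV
  have hVpos : 0 < V := by positivity
  obtain ⟨v, hv⟩ : ∃ v : ℝ≥0, (v : ℝ) = V := ⟨⟨V, hVpos.le⟩, rfl⟩
  obtain ⟨v₀, hv₀⟩ : ∃ v₀ : ℝ≥0, (v₀ : ℝ) = g ^ 2 := ⟨⟨g ^ 2, by positivity⟩, rfl⟩
  have hv0 : v ≠ 0 := by rw [← NNReal.coe_ne_zero, hv]; exact hVpos.ne'
  have hv₀0 : v₀ ≠ 0 := by rw [← NNReal.coe_ne_zero, hv₀]; positivity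
  have hr : ((p / g) ^ 2 + 1) * (v₀ : ℝ) = 1 := by rw [hv₀]; field_simp; exact hpg
  have hrl : ((p / g - l) ^ 2 + 1) * (v₀ : ℝ) = (p - l * g) ^ 2 + g ^ 2 := by
    rw [hv₀]; field_simp
  have b₁ := user_bound hM₁ hM₂ hv₀0 hv0 hr l d c h C.enc₁ C.enc₂ C.measurable_dec₁
  have b₂ := user_bound hM₂ hM₁ hv₀0 hv0 hr l d c h C.enc₂ C.enc₁ C.measurable_dec₂
  have e₁ : (M₁ : ℝ)⁻¹ * ∑ w, (M₂ : ℝ)⁻¹ * ∑ w', (noise n).real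
      {z | C.dec₁ (fun t => received d c h (C.enc₁ w t) (C.enc₂ w' t) (z t)) ≠ w} =
      C.errorProb₁ d c h := by
    rw [Code.errorProb₁, mul_inv, mul_assoc]
    congr 1
    rw [Finset.mul_sum]
  have e₂ : (M₂ : ℝ)⁻¹ * ∑ w, (M₁ : ℝ)⁻¹ * ∑ w', (noise n).real
      {z | C.dec₂ (fun t => received d c h (C.enc₂ w t) (C.enc₁ w' t) (z t)) ≠ w} =
      C.errorProb₂ d c h := by
    rw [Code.errorProb₂, mul_inv, mul_comm (M₁ : ℝ)⁻¹, mul_assoc, Finset.sum_comm]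
    congr 1
    rw [Finset.mul_sum]
  have energy : ∀ {M : ℕ} {enc : Fin M → Fin n → EuclideanSpace ℝ (Fin m)},
      inputCovariance enc ∈ covarianceConstraint m P →
      (M : ℝ)⁻¹ * (∑ w, ∑ t, (inner ℝ d (enc w t) - l * (h * inner ℝ c (enc w t))) ^ 2) +
        (M : ℝ)⁻¹ * (∑ w, ∑ t, (h * inner ℝ c (enc w t)) ^ 2) ≤ n * (P * t) := by
    intro M enc henc
    have h1 := sum_norm_sq_le hn henc
    rw [← mul_add, ← Finset.sum_add_distrib]
    simp_rw [← Finset.sum_add_distrib]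
    calc _ ≤ (M : ℝ)⁻¹ * ∑ w, ∑ i, t * ‖enc w i‖ ^ 2 := by
          gcongr with w _ i _
          exact quadratic_form_le hd hc hθ hsin ht hform _
      _ = t * ((M : ℝ)⁻¹ * ∑ w, ∑ i, ‖enc w i‖ ^ 2) := by
          simp_rw [← Finset.mul_sum]; ring
      _ ≤ t * (n * P) := mul_le_mul_of_nonneg_left h1 ht
      _ = n * (P * t) := by ring
  have en₁ := energy hC₁
  have en₂ := energy hC₂
  rw [e₁, hrl, hv, hv₀] at b₁
  rw [e₂, hrl, hv, hv₀] at b₂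
  have hlog : Real.log (2 * Real.pi * V) - Real.log (2 * Real.pi * g ^ 2) =
      Real.log (V / g ^ 2) := by
    rw [← Real.log_div (by positivity) (by positivity)]
    congr 1
    field_simp
  have hfrac : ∀ {x y : ℝ}, x + y ≤ 2 * (n * V) → x / (2 * V) + y / (2 * V) ≤ n := by
    intro x y hxy
    rw [← add_div, div_le_iff₀ (by positivity)]
    linarith
  have hsum := hfrac (x := (M₁ : ℝ)⁻¹ * (∑ w, ∑ t, (inner ℝ d (C.enc₁ w t) -
      l * (h * inner ℝ c (C.enc₁ w t))) ^ 2) +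
        (M₂ : ℝ)⁻¹ * (∑ w, ∑ t, (h * inner ℝ c (C.enc₂ w t)) ^ 2) +
        n * ((p - l * g) ^ 2 + g ^ 2))
      (y := (M₂ : ℝ)⁻¹ * (∑ w, ∑ t, (inner ℝ d (C.enc₂ w t) -
      l * (h * inner ℝ c (C.enc₂ w t))) ^ 2) +
        (M₁ : ℝ)⁻¹ * (∑ w, ∑ t, (h * inner ℝ c (C.enc₁ w t)) ^ 2) +
        n * ((p - l * g) ^ 2 + g ^ 2)) (by rw [hV, mul_add]; linarith)
  rw [← hlog]
  linarith

/-- A bound on the code sizes by `exp (n S)`, up to the loss from decoding errors, carries over to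
the achievable rates. -/
lemma add_le_of_achievable {m : ℕ} {d c : EuclideanSpace ℝ (Fin m)} {h P R₁ R₂ S : ℝ}
    (hS : ∀ (n M₁ M₂ : ℕ) (C : Code m n M₁ M₂), 0 < n → M₁ ≠ 0 → M₂ ≠ 0 →
      inputCovariance C.enc₁ ∈ covarianceConstraint m P →
      inputCovariance C.enc₂ ∈ covarianceConstraint m P →
      (1 - C.errorProb₁ d c h) * Real.log M₁ + (1 - C.errorProb₂ d c h) * Real.log M₂ -
        2 * Real.log 2 ≤ n * S)
    (hR : Achievable d c h P R₁ R₂) : R₁ + R₂ ≤ S := by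
  obtain ⟨hR₁, hR₂, hR⟩ := hR
  by_contra! hlt
  obtain ⟨ε, hε0, hε1, hε⟩ : ∃ ε : ℝ, 0 < ε ∧ ε < 1 ∧ S < (1 - ε) * (R₁ + R₂) := by
    have hc : ContinuousAt (fun ε : ℝ => (1 - ε) * (R₁ + R₂)) 0 := by fun_prop
    have h1 : ∀ᶠ ε in nhdsWithin (0 : ℝ) (Set.Ioi 0), S < (1 - ε) * (R₁ + R₂) :=
      nhdsWithin_le_nhds (hc.eventually (lt_mem_nhds (by simpa using hlt)))
    have h2 : ∀ᶠ ε in nhdsWithin (0 : ℝ) (Set.Ioi 0), ε < 1 :=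
      nhdsWithin_le_nhds (gt_mem_nhds one_pos)
    obtain ⟨ε, h3, h4, h5⟩ := (h1.and (h2.and self_mem_nhdsWithin)).exists
    exact ⟨ε, h5, h4, h3⟩
  have hlarge : ∀ᶠ n : ℕ in atTop, 2 * Real.log 2 < n * ((1 - ε) * (R₁ + R₂) - S) :=
    (tendsto_natCast_atTop_atTop.atTop_mul_const (sub_pos.2 hε)).eventually_gt_atTop _
  obtain ⟨n, ⟨⟨M₁, M₂, C, h1, h2, h3, h4, h5, h6⟩, hn⟩, hn0⟩ :=
    (((hR ε hε0).and hlarge).and (eventually_gt_atTop 0)).exists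
  have hM₁ : (0 : ℝ) < M₁ := (Real.exp_pos _).trans_le h1
  have hM₂ : (0 : ℝ) < M₂ := (Real.exp_pos _).trans_le h2
  have hb := hS n M₁ M₂ C hn0 (by exact_mod_cast hM₁.ne') (by exact_mod_cast hM₂.ne') h3 h4
  have l1 : n * R₁ ≤ Real.log M₁ := (Real.le_log_iff_exp_le hM₁).2 h1
  have l2 : n * R₂ ≤ Real.log M₂ := (Real.le_log_iff_exp_le hM₂).2 h2
  have k1 : (1 - ε) * (n * R₁) ≤ (1 - C.errorProb₁ d c h) * Real.log M₁ :=
    mul_le_mul (by linarith) l1 (by positivity) (by linarith)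
  have k2 : (1 - ε) * (n * R₂) ≤ (1 - C.errorProb₂ d c h) * Real.log M₂ :=
    mul_le_mul (by linarith) l2 (by positivity) (by linarith)
  nlinarith

end Converse

/-! ### Likelihood test -/

section LikelihoodTest

variable {ι : Type*} [Fintype ι]

/-- The pairs of a codeword `x` and a received word `y` for which the likelihood of `y`, given `x`
sent with gain `a` in noise of variance `N`, exceeds its likelihood under variance `V` by more than
the factor `exp (n T)`, for block length `n`. -/
def testSet (a : ℝ) (N V : ℝ≥0) (T : ℝ) : Set ((ι → ℝ) × (ι → ℝ)) :=
  {p | Real.exp (Fintype.card ι * T) * gaussDensity V p.2 < gaussDensity N (p.2 - a • p.1)}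

lemma measurableSet_testSet (a : ℝ) (N V : ℝ≥0) (T : ℝ) :
    MeasurableSet (testSet (ι := ι) a N V T) := by
  have h1 := measurable_gaussDensity (ι := ι) V
  have h2 := measurable_gaussDensity (ι := ι) N
  exact measurableSet_lt (by fun_prop) (by fun_prop)

/-- An independent codeword passes the test with exponentially small probability. -/
lemma measure_testSet_le (a : ℝ) {N V : ℝ≥0} (hN : N ≠ 0) (hV : V ≠ 0) (T : ℝ)
    (μ : Measure (ι → ℝ)) [IsProbabilityMeasure μ] :
    (μ.prod (gaussPi ι V)) (testSet a N V T) ≤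
      ENNReal.ofReal (Real.exp (-(Fintype.card ι * T))) := by
  have hmN := measurable_gaussDensity (ι := ι) N
  have hmV := measurable_gaussDensity (ι := ι) V
  have hS := measurableSet_testSet (ι := ι) a N V T
  rw [Measure.prod_apply hS]
  have hx : ∀ x : ι → ℝ, gaussPi ι V (Prod.mk x ⁻¹' testSet a N V T) ≤
      ENNReal.ofReal (Real.exp (-(Fintype.card ι * T))) := by
    intro x
    have hSx : MeasurableSet (Prod.mk x ⁻¹' testSet a N V T) := measurable_prodMk_left hS
    rw [gaussPi_eq_withDensity hV, withDensity_apply _ hSx]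
    calc ∫⁻ y in Prod.mk x ⁻¹' testSet a N V T, ENNReal.ofReal (gaussDensity V y)
        ≤ ∫⁻ y in Prod.mk x ⁻¹' testSet a N V T,
            ENNReal.ofReal (Real.exp (-(Fintype.card ι * T))) *
              ENNReal.ofReal (gaussDensity N (y - a • x)) := by
          refine setLIntegral_mono (by fun_prop) fun y hy => ?_
          rw [← ENNReal.ofReal_mul (Real.exp_pos _).le]
          refine ENNReal.ofReal_le_ofReal ?_
          have h : Real.exp (Fintype.card ι * T) * gaussDensity V y <
            gaussDensity N (y - a • x) := hy
          rw [Real.exp_neg, ← div_eq_inv_mul, le_div_iff₀ (Real.exp_pos _), mul_comm]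
          exact h.le
      _ ≤ ∫⁻ y, ENNReal.ofReal (Real.exp (-(Fintype.card ι * T))) *
              ENNReal.ofReal (gaussDensity N (y - a • x)) := setLIntegral_le_lintegral _ _
      _ = ENNReal.ofReal (Real.exp (-(Fintype.card ι * T))) := by
          rw [lintegral_const_mul _ (by fun_prop),
            lintegral_sub_right_eq_self (fun y => ENNReal.ofReal (gaussDensity N y)),
            lintegral_ofReal_gaussDensity hN, mul_one]
  refine (lintegral_mono hx).trans_eq ?_
  simp

/-- The deviation of the empirical second moment of Gaussian noise, in Chebyshev form. -/
lemma gaussPi_deviation_le (v : ℝ≥0) {η : ℝ} (hη : 0 < η) (hι : 0 < Fintype.card ι) :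
    gaussPi ι v {x | Fintype.card ι * η ≤ |∑ i, x i ^ 2 - Fintype.card ι * v|} ≤
      ENNReal.ofReal (variance (fun x : ℝ => x ^ 2) (gaussianReal 0 v) / η ^ 2 /
        Fintype.card ι) := by
  have h := measure_sum_deviation_le (ι := ι) (gaussianReal 0 v) (memLp_sq_gaussianReal v) hη hι
  rw [integral_sq_gaussianReal] at h
  refine h.trans_eq ?_
  rw [div_div, mul_comm (η ^ 2)]

/-- The transmitted codeword fails the test with vanishing probability, if the threshold is below
the mutual information. -/
lemma measure_compl_testSet_le (a : ℝ) {q N V : ℝ≥0} (hN : N ≠ 0)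
    (hV : (V : ℝ) = a ^ 2 * q + N) {T : ℝ} (hT : T < 1 / 2 * Real.log (V / N)) :
    ∃ K : ℝ, 0 ≤ K ∧ ∀ (n : ℕ), 0 < n →
      ((gaussPi (Fin n) q).prod (gaussPi (Fin n) N)) {p | (p.1, a • p.1 + p.2) ∉ testSet a N V T} ≤
        ENNReal.ofReal (K / n) := by
  have hN' : (0 : ℝ) < N := by positivity
  have hV' : (0 : ℝ) < V := by rw [hV]; positivity
  have hV0 : V ≠ 0 := by rw [← NNReal.coe_ne_zero]; exact hV'.ne'
  set η := 1 / 2 * Real.log (V / N) - T with hη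
  have hη0 : 0 < η := by linarith
  set K₁ := variance (fun x : ℝ => x ^ 2) (gaussianReal 0 N) / (N * η) ^ 2
  set K₂ := variance (fun x : ℝ => x ^ 2) (gaussianReal 0 V) / (V * η) ^ 2
  have hK₁ : 0 ≤ K₁ := div_nonneg (variance_nonneg _ _) (sq_nonneg _)
  have hK₂ : 0 ≤ K₂ := div_nonneg (variance_nonneg _ _) (sq_nonneg _)
  refine ⟨K₁ + K₂, by positivity, fun n hn => ?_⟩
  have hn' : (0 : ℝ) < n := by exact_mod_cast hn
  have d₁ := gaussPi_deviation_le (ι := Fin n) N (η := N * η) (by positivity) (by simpa using hn)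
  have d₂ := gaussPi_deviation_le (ι := Fin n) V (η := V * η) (by positivity) (by simpa using hn)
  rw [Fintype.card_fin] at d₁ d₂
  set S₁ := {z : Fin n → ℝ | n * (N * η) ≤ |∑ i, z i ^ 2 - n * N|}
  set S₂ := {z : Fin n → ℝ | n * (V * η) ≤ |∑ i, z i ^ 2 - n * V|}
  have hmp₁ : MeasurePreserving (fun p : (Fin n → ℝ) × (Fin n → ℝ) => p.2)
      ((gaussPi (Fin n) q).prod (gaussPi (Fin n) N)) (gaussPi (Fin n) N) := measurePreserving_snd
  have hmp₂ : MeasurePreserving (fun (p : (Fin n → ℝ) × (Fin n → ℝ)) i => a * p.1 i + p.2 i)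
      ((gaussPi (Fin n) q).prod (gaussPi (Fin n) N)) (gaussPi (Fin n) V) :=
    ⟨by fun_prop, map_linear_prod_gaussPi a q N V hV⟩
  have hS₁ : MeasurableSet S₁ := measurableSet_le (by fun_prop) (by fun_prop)
  have hS₂ : MeasurableSet S₂ := measurableSet_le (by fun_prop) (by fun_prop)
  have hsub : {p : (Fin n → ℝ) × (Fin n → ℝ) | (p.1, a • p.1 + p.2) ∉ testSet a N V T} ⊆
      (fun p => p.2) ⁻¹' S₁ ∪ (fun p i => a * p.1 i + p.2 i) ⁻¹' S₂ := by
    intro p hp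
    have h1 : ¬ (Real.exp (n * T) * gaussDensity V (a • p.1 + p.2) <
        gaussDensity N (a • p.1 + p.2 - a • p.1)) := by
      have h0 := hp
      simp only [testSet, Set.mem_ofPred_eq, Fintype.card_fin] at h0
      exact h0
    rw [not_lt, add_sub_cancel_left] at h1
    have h2 := Real.log_le_log (gaussDensity_pos hN _) h1
    rw [Real.log_mul (Real.exp_pos _).ne' (gaussDensity_pos hV0 _).ne', Real.log_exp,
      log_gaussDensity hN, log_gaussDensity hV0, Fintype.card_fin] at h2
    have hlog : Real.log (2 * Real.pi * V) - Real.log (2 * Real.pi * N) = Real.log (V / N) := by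
      rw [← Real.log_div (by positivity) (by positivity)]
      congr 1
      field_simp
    by_contra hcon
    simp only [Set.mem_union, Set.mem_preimage, S₁, S₂, Set.mem_ofPred_eq, not_or, not_le] at hcon
    obtain ⟨c1, c2⟩ := hcon
    simp only [Pi.add_apply, Pi.smul_apply, smul_eq_mul] at h2
    have c1' := (abs_lt.1 c1).2
    have c2' := (abs_lt.1 c2).1
    set Z := ∑ i, p.2 i ^ 2
    set Y := ∑ i, (a * p.1 i + p.2 i) ^ 2
    have e1 : Z / (2 * N) < n / 2 + n * η / 2 := by
      rw [div_lt_iff₀ (by positivity)]; linarith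
    have e2 : n / 2 - n * η / 2 < Y / (2 * V) := by
      rw [lt_div_iff₀ (by positivity)]; linarith
    have e3 : n * η = n / 2 * (Real.log (2 * Real.pi * V) - Real.log (2 * Real.pi * N)) - n * T := by
      rw [hη, hlog]; ring
    linarith
  calc _ ≤ ((gaussPi (Fin n) q).prod (gaussPi (Fin n) N)) ((fun p => p.2) ⁻¹' S₁) +
        ((gaussPi (Fin n) q).prod (gaussPi (Fin n) N))
          ((fun p i => a * p.1 i + p.2 i) ⁻¹' S₂) :=
        (measure_mono hsub).trans (measure_union_le _ _)
    _ = gaussPi (Fin n) N S₁ + gaussPi (Fin n) V S₂ := by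
        rw [hmp₁.measure_preimage hS₁.nullMeasurableSet,
          hmp₂.measure_preimage hS₂.nullMeasurableSet]
    _ ≤ ENNReal.ofReal (K₁ / n) + ENNReal.ofReal (K₂ / n) := add_le_add d₁ d₂
    _ = ENNReal.ofReal ((K₁ + K₂) / n) := by
        rw [← ENNReal.ofReal_add (by positivity) (by positivity), add_div]

/-- A random codebook exceeds the power constraint with vanishing probability. -/
lemma measure_power_excess_le {q : ℝ≥0} {P : ℝ} (hP : (q : ℝ) < P) :
    ∃ K : ℝ, 0 ≤ K ∧ ∀ n M : ℕ, 0 < n → 0 < M →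
      (Measure.pi fun _ : Fin M => gaussPi (Fin n) q)
        {s | ¬ (n : ℝ)⁻¹ * ∑ t, (M : ℝ)⁻¹ * ∑ w, s w t ^ 2 ≤ P} ≤ ENNReal.ofReal (K / n) := by
  set κ := variance (fun x : ℝ => x ^ 2) (gaussianReal 0 q)
  have hκ : 0 ≤ κ := variance_nonneg _ _
  refine ⟨κ / (P - q) ^ 2, by positivity, fun n M hn hM => ?_⟩
  have hn' : (0 : ℝ) < n := by exact_mod_cast hn
  have hM' : (0 : ℝ) < M := by exact_mod_cast hM
  have hM1 : (1 : ℝ) ≤ M := by exact_mod_cast hM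
  set f : (Fin n → ℝ) → ℝ := fun x => (n : ℝ)⁻¹ * ∑ t, x t ^ 2 with hf
  have hsum : MemLp (fun x : Fin n → ℝ => ∑ t, x t ^ 2) 2 (gaussPi (Fin n) q) :=
    memLp_finsetSum _ fun t _ =>
      (memLp_sq_gaussianReal q).comp_measurePreserving (measurePreserving_eval_gaussPi q t)
  have hfm : MemLp f 2 (gaussPi (Fin n) q) := hsum.const_mul _
  have hEf : ∫ x, f x ∂(gaussPi (Fin n) q) = q := by
    simp only [hf]
    rw [integral_const_mul, integral_finsetSum _ fun i _ => integrable_eval_sq_gaussPi q i]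
    simp_rw [integral_eval_sq_gaussPi]
    simp
    field_simp
  have hVf : variance f (gaussPi (Fin n) q) = κ / n := by
    simp only [hf]
    rw [variance_const_mul]
    have h := variance_sum_pi (ι := Fin n) (μ := fun _ => gaussianReal 0 q)
      (X := fun _ (x : ℝ) => x ^ 2) fun _ => memLp_sq_gaussianReal q
    have h2 : (∑ i : Fin n, fun x : Fin n → ℝ => x i ^ 2) = fun x => ∑ i, x i ^ 2 := by
      ext x; simp
    rw [h2] at h
    rw [gaussPi, h]
    simp
    field_simp
    rfl
  have h := measure_sum_deviation_le (ι := Fin M) (gaussPi (Fin n) q) hfm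
    (a := P - q) (by linarith) (by simpa using hM)
  rw [hEf, hVf, Fintype.card_fin] at h
  refine (measure_mono fun s hs => ?_).trans (h.trans (ENNReal.ofReal_le_ofReal ?_))
  · simp only [Set.mem_ofPred_eq, not_le] at hs ⊢
    refine le_trans ?_ (le_abs_self _)
    have hswap : (n : ℝ)⁻¹ * ∑ t, (M : ℝ)⁻¹ * ∑ w, s w t ^ 2 = (M : ℝ)⁻¹ * ∑ w, f (s w) := by
      simp only [hf]
      rw [← Finset.mul_sum, ← Finset.mul_sum, Finset.sum_comm]
      ring
    rw [hswap, lt_inv_mul_iff₀ hM'] at hs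
    linarith
  · rw [div_div, div_div]
    have hPq : 0 < (P - q) ^ 2 := by
      have : 0 < P - q := by linarith
      positivity
    refine div_le_div_of_nonneg_left hκ (by positivity) ?_
    have : n * (P - q) ^ 2 * 1 ≤ n * (P - q) ^ 2 * M := by gcongr
    linarith

end LikelihoodTest

/-! ### Random coding -/

section RandomCoding

/-- The law of a random codebook of `M` codewords of length `n` with i.i.d. Gaussian symbols. -/
def codebookLaw (M n : ℕ) (q : ℝ≥0) : Measure (Fin M → Fin n → ℝ) :=
  Measure.pi fun _ => gaussPi (Fin n) q

instance (M n : ℕ) (q : ℝ≥0) : IsProbabilityMeasure (codebookLaw M n q) := by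
  unfold codebookLaw; infer_instance

instance (n : ℕ) : IsProbabilityMeasure (noise n) := by
  unfold noise; infer_instance

variable {n M : ℕ}

/-- A union bound on the error probability of the test decoder, when the user has the codebook `s`
and gain `a`, and the interferer has the codebook `s'` and gain `e`. -/
def errorBound (a e : ℝ) (B : Set ((Fin n → ℝ) × (Fin n → ℝ))) (s s' : Fin M → Fin n → ℝ) :
    ℝ≥0∞ :=
  (M : ℝ≥0∞)⁻¹ * ∑ w, (M : ℝ≥0∞)⁻¹ * ∑ w',
    (noise n {z | (s w, a • s w + (e • s' w' + z)) ∈ Bᶜ} +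
      ∑ w₁ ∈ Finset.univ.erase w, noise n {z | (s w₁, a • s w + (e • s' w' + z)) ∈ B})

lemma measurable_noise_slice {B : Set ((Fin n → ℝ) × (Fin n → ℝ))} (hB : MeasurableSet B)
    (a e : ℝ) (w₁ w w' : Fin M) :
    Measurable fun p : (Fin M → Fin n → ℝ) × (Fin M → Fin n → ℝ) =>
      noise n {z | (p.1 w₁, a • p.1 w + (e • p.2 w' + z)) ∈ B} := by
  have hf : Measurable fun x : ((Fin M → Fin n → ℝ) × (Fin M → Fin n → ℝ)) × (Fin n → ℝ) =>
      (x.1.1 w₁, a • x.1.1 w + (e • x.1.2 w' + x.2)) := by fun_prop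
  exact measurable_measure_prodMk_left (hf hB)

lemma measurable_errorBound {B : Set ((Fin n → ℝ) × (Fin n → ℝ))} (hB : MeasurableSet B)
    (a e : ℝ) : Measurable fun p : (Fin M → Fin n → ℝ) × (Fin M → Fin n → ℝ) =>
      errorBound a e B p.1 p.2 := by
  unfold errorBound
  refine Measurable.const_mul (Finset.measurable_sum _ fun w _ => Measurable.const_mul
    (Finset.measurable_sum _ fun w' _ => ?_) _) _
  exact (measurable_noise_slice hB.compl a e w w w').add
    (Finset.measurable_sum _ fun w₁ _ => measurable_noise_slice hB a e w₁ w w')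

/-- Interference from a Gaussian codeword and the receiver noise add up to Gaussian noise. -/
lemma measurePreserving_interference_add_noise {e : ℝ} {q N : ℝ≥0} (hN : (N : ℝ) = e ^ 2 * q + 1)
    (w' : Fin M) :
    MeasurePreserving (fun p : (Fin M → Fin n → ℝ) × (Fin n → ℝ) => e • p.1 w' + p.2)
      ((codebookLaw M n q).prod (noise n)) (gaussPi (Fin n) N) := by
  have h1 : MeasurePreserving (fun s : Fin M → Fin n → ℝ => s w') (codebookLaw M n q)
      (gaussPi (Fin n) q) := measurePreserving_eval (fun _ => gaussPi (Fin n) q) w'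
  have h2 : MeasurePreserving (fun (p : (Fin n → ℝ) × (Fin n → ℝ)) i => e * p.1 i + p.2 i)
      ((gaussPi (Fin n) q).prod (gaussPi (Fin n) 1)) (gaussPi (Fin n) N) :=
    ⟨by fun_prop, map_linear_prod_gaussPi e q 1 N (by rw [hN]; simp)⟩
  exact h2.comp (h1.prod (MeasurePreserving.id (noise n)))

lemma lintegral_noise_slice {B : Set ((Fin n → ℝ) × (Fin n → ℝ))} (hB : MeasurableSet B)
    (a : ℝ) {e : ℝ} {q N : ℝ≥0} (hN : (N : ℝ) = e ^ 2 * q + 1) (w₁ w w' : Fin M)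
    {ν : Measure ((Fin n → ℝ) × (Fin n → ℝ))}
    (hν : MeasurePreserving (fun p : (Fin M → Fin n → ℝ) × (Fin n → ℝ) =>
      (p.1 w₁, a • p.1 w + p.2)) ((codebookLaw M n q).prod (gaussPi (Fin n) N)) ν) :
    ∫⁻ p : (Fin M → Fin n → ℝ) × (Fin M → Fin n → ℝ),
        noise n {z | (p.1 w₁, a • p.1 w + (e • p.2 w' + z)) ∈ B}
        ∂((codebookLaw M n q).prod (codebookLaw M n q)) = ν B := by
  have hf : Measurable fun x : ((Fin M → Fin n → ℝ) × (Fin M → Fin n → ℝ)) × (Fin n → ℝ) =>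
      (x.1.1 w₁, a • x.1.1 w + (e • x.1.2 w' + x.2)) := by fun_prop
  have h1 : MeasurePreserving
      (fun x : ((Fin M → Fin n → ℝ) × (Fin M → Fin n → ℝ)) × (Fin n → ℝ) =>
      (x.1.1 w₁, a • x.1.1 w + (e • x.1.2 w' + x.2)))
      (((codebookLaw M n q).prod (codebookLaw M n q)).prod (noise n)) ν :=
    (hν.comp ((MeasurePreserving.id (codebookLaw M n q)).prod
      (measurePreserving_interference_add_noise hN w'))).comp
      (measurePreserving_prodAssoc (codebookLaw M n q) (codebookLaw M n q) (noise n))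
  rw [← h1.measure_preimage hB.nullMeasurableSet, Measure.prod_apply (hf hB)]
  rfl

/-- The transmitted codeword and the noise are independent. -/
lemma measurePreserving_codeword {a : ℝ} {q N : ℝ≥0} (w : Fin M) :
    MeasurePreserving (fun p : (Fin M → Fin n → ℝ) × (Fin n → ℝ) => (p.1 w, a • p.1 w + p.2))
      ((codebookLaw M n q).prod (gaussPi (Fin n) N))
      (((gaussPi (Fin n) q).prod (gaussPi (Fin n) N)).map fun p => (p.1, a • p.1 + p.2)) := by
  have h1 : MeasurePreserving (fun s : Fin M → Fin n → ℝ => s w) (codebookLaw M n q)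
      (gaussPi (Fin n) q) := measurePreserving_eval (fun _ => gaussPi (Fin n) q) w
  have h2 : MeasurePreserving (fun p : (Fin n → ℝ) × (Fin n → ℝ) => (p.1, a • p.1 + p.2))
      ((gaussPi (Fin n) q).prod (gaussPi (Fin n) N)) _ :=
    (show Measurable _ by fun_prop).measurePreserving _
  exact h2.comp (h1.prod (MeasurePreserving.id (gaussPi (Fin n) N)))

/-- A codeword that was not sent is independent of the received word. -/
lemma measurePreserving_other_codeword {a : ℝ} {q N V : ℝ≥0} (hV : (V : ℝ) = a ^ 2 * q + N)
    {w₁ w : Fin M} (hw : w₁ ≠ w) :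
    MeasurePreserving (fun p : (Fin M → Fin n → ℝ) × (Fin n → ℝ) => (p.1 w₁, a • p.1 w + p.2))
      ((codebookLaw M n q).prod (gaussPi (Fin n) N))
      ((gaussPi (Fin n) q).prod (gaussPi (Fin n) V)) := by
  have hev : ∀ w, MeasurePreserving (fun s : Fin M → Fin n → ℝ => s w) (codebookLaw M n q)
      (gaussPi (Fin n) q) := fun w => measurePreserving_eval (fun _ => gaussPi (Fin n) q) w
  have h1 : MeasurePreserving (fun s : Fin M → Fin n → ℝ => (s w₁, s w)) (codebookLaw M n q)
      ((gaussPi (Fin n) q).prod (gaussPi (Fin n) q)) := by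
    refine ⟨by fun_prop, ?_⟩
    have hind := (iIndepFun_pi (μ := fun _ : Fin M => gaussPi (Fin n) q)
      (X := fun _ (x : Fin n → ℝ) => x) fun _ => by fun_prop).indepFun hw
    rw [indepFun_iff_map_prod_eq_prod_map_map (measurable_pi_apply w₁).aemeasurable
      (measurable_pi_apply w).aemeasurable] at hind
    exact hind.trans (congrArg₂ Measure.prod (hev w₁).map_eq (hev w).map_eq)
  have h2 : MeasurePreserving (fun p : (Fin n → ℝ) × (Fin n → ℝ) => a • p.1 + p.2)
      ((gaussPi (Fin n) q).prod (gaussPi (Fin n) N)) (gaussPi (Fin n) V) :=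
    ⟨by fun_prop, map_linear_prod_gaussPi a q N V hV⟩
  exact ((MeasurePreserving.id (gaussPi (Fin n) q)).prod h2).comp
    ((measurePreserving_prodAssoc _ _ _).comp
      (h1.prod (MeasurePreserving.id (gaussPi (Fin n) N))))

lemma average_le {c : ℝ≥0∞} {f : Fin M → ℝ≥0∞} (hf : ∀ w, f w ≤ c) :
    (M : ℝ≥0∞)⁻¹ * ∑ w, f w ≤ c := by
  rcases Nat.eq_zero_or_pos M with rfl | hM
  · simp
  · calc (M : ℝ≥0∞)⁻¹ * ∑ w, f w ≤ (M : ℝ≥0∞)⁻¹ * (M * c) := by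
          gcongr
          refine (Finset.sum_le_sum fun w _ => hf w).trans_eq ?_
          simp
      _ = c := by
          rw [← mul_assoc, ENNReal.inv_mul_cancel (by exact_mod_cast hM.ne') (by simp), one_mul]

/-- The expected union bound over random codebooks: `K` for rejecting the sent codeword, and one
exponentially small term for each other codeword. -/
lemma lintegral_errorBound_le {a e T : ℝ} {q N V : ℝ≥0} (hN : (N : ℝ) = e ^ 2 * q + 1)
    (hV : (V : ℝ) = a ^ 2 * q + N) {K : ℝ}
    (hK : ((gaussPi (Fin n) q).prod (gaussPi (Fin n) N))
      {p | (p.1, a • p.1 + p.2) ∉ testSet a N V T} ≤ ENNReal.ofReal K) :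
    ∫⁻ p : (Fin M → Fin n → ℝ) × (Fin M → Fin n → ℝ), errorBound a e (testSet a N V T) p.1 p.2
      ∂((codebookLaw M n q).prod (codebookLaw M n q)) ≤
      ENNReal.ofReal K + M * ENNReal.ofReal (Real.exp (-(n * T))) := by
  have hNpos : (0 : ℝ) < N := by rw [hN]; positivity
  have hVpos : (0 : ℝ) < V := by rw [hV]; positivity
  have hN0 : N ≠ 0 := by rw [← NNReal.coe_ne_zero]; exact hNpos.ne'
  have hV0 : V ≠ 0 := by rw [← NNReal.coe_ne_zero]; exact hVpos.ne'
  set B := testSet (ι := Fin n) a N V T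
  have hB : MeasurableSet B := measurableSet_testSet a N V T
  have m1 := fun w w' : Fin M => measurable_noise_slice hB.compl a e w w w'
  have m2 := fun w₁ w w' : Fin M => measurable_noise_slice hB a e w₁ w w'
  have m3 : ∀ w w' : Fin M, Measurable fun p : (Fin M → Fin n → ℝ) × (Fin M → Fin n → ℝ) =>
      noise n {z | (p.1 w, a • p.1 w + (e • p.2 w' + z)) ∈ Bᶜ} +
        ∑ w₁ ∈ Finset.univ.erase w, noise n {z | (p.1 w₁, a • p.1 w + (e • p.2 w' + z)) ∈ B} :=
    fun w w' => (m1 w w').add (Finset.measurable_sum _ fun w₁ _ => m2 w₁ w w')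
  have m4 : ∀ w : Fin M, Measurable fun p : (Fin M → Fin n → ℝ) × (Fin M → Fin n → ℝ) =>
      (M : ℝ≥0∞)⁻¹ * ∑ w', (noise n {z | (p.1 w, a • p.1 w + (e • p.2 w' + z)) ∈ Bᶜ} +
        ∑ w₁ ∈ Finset.univ.erase w, noise n {z | (p.1 w₁, a • p.1 w + (e • p.2 w' + z)) ∈ B}) :=
    fun w => (Finset.measurable_sum _ fun w' _ => m3 w w').const_mul _
  unfold errorBound
  rw [lintegral_const_mul _ (Finset.measurable_sum _ fun w _ => m4 w),
    lintegral_finsetSum _ fun w _ => m4 w]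
  refine average_le fun w => ?_
  rw [lintegral_const_mul _ (Finset.measurable_sum _ fun w' _ => m3 w w'),
    lintegral_finsetSum _ fun w' _ => m3 w w']
  refine average_le fun w' => ?_
  rw [lintegral_add_left (m1 w w'), lintegral_finsetSum _ fun w₁ _ => m2 w₁ w w',
    lintegral_noise_slice hB.compl a hN w w w' (measurePreserving_codeword w),
    Measure.map_apply (by fun_prop) hB.compl]
  refine add_le_add hK ?_
  have hother : ∀ w₁ ∈ Finset.univ.erase w,
      ∫⁻ p : (Fin M → Fin n → ℝ) × (Fin M → Fin n → ℝ),
        noise n {z | (p.1 w₁, a • p.1 w + (e • p.2 w' + z)) ∈ B}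
        ∂((codebookLaw M n q).prod (codebookLaw M n q)) ≤
      ENNReal.ofReal (Real.exp (-(n * T))) := by
    intro w₁ hw₁
    rw [lintegral_noise_slice hB a hN w₁ w w'
      (measurePreserving_other_codeword hV (Finset.ne_of_mem_erase hw₁))]
    have := measure_testSet_le (ι := Fin n) a hN0 hV0 T (gaussPi (Fin n) q)
    rwa [Fintype.card_fin] at this
  refine (Finset.sum_le_sum hother).trans ?_
  rw [Finset.sum_const, nsmul_eq_mul]
  gcongr
  exact (Finset.card_le_univ _).trans_eq (Fintype.card_fin M)

/-- A decoder that returns a message whose test region contains the received word. -/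
lemma exists_decoder {Y : Type*} [MeasurableSpace Y] (hM : 0 < M) {D : Fin M → Set Y}
    (hD : ∀ w, MeasurableSet (D w)) :
    ∃ dec : Y → Fin M, Measurable dec ∧
      ∀ w y, dec y ≠ w → y ∈ (D w)ᶜ ∨ ∃ w₁ ≠ w, y ∈ D w₁ := by
  classical
  let pick : (Fin M → Prop) → Fin M := fun f =>
    if hf : ∃ w, f w then hf.choose else ⟨0, hM⟩
  refine ⟨fun y => pick fun w => y ∈ D w, ?_, fun w y hne => ?_⟩
  · have h1 : Measurable fun (y : Y) (w : Fin M) => y ∈ D w :=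
      measurable_pi_lambda _ fun w => measurable_mem.2 (hD w)
    exact (measurable_of_finite pick).comp h1
  · by_cases hy : y ∈ D w
    · right
      have hex : ∃ w, y ∈ D w := ⟨w, hy⟩
      have hp : pick (fun w => y ∈ D w) = hex.choose := dif_pos hex
      exact ⟨_, hne, (hp.symm ▸ hex.choose_spec : y ∈ D (pick fun w => y ∈ D w))⟩
    · exact Or.inl hy

/-- The test decoder meets the union bound. -/
lemma exists_decoder_errorBound (hM : 0 < M) {B : Set ((Fin n → ℝ) × (Fin n → ℝ))}
    (hB : MeasurableSet B) (a e : ℝ) (s : Fin M → Fin n → ℝ) :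
    ∃ dec : (Fin n → ℝ) → Fin M, Measurable dec ∧ ∀ s' : Fin M → Fin n → ℝ, ∀ ε : ℝ, 0 ≤ ε →
      errorBound a e B s s' ≤ ENNReal.ofReal ε →
      (M : ℝ)⁻¹ * ∑ w, (M : ℝ)⁻¹ * ∑ w', (noise n).real
        {z | dec (fun t => a * s w t + e * s' w' t + z t) ≠ w} ≤ ε := by
  obtain ⟨dec, hdec, herr⟩ := exists_decoder (Y := Fin n → ℝ) hM (D := fun w => Prod.mk (s w) ⁻¹' B)
    fun w => measurable_prodMk_left hB
  refine ⟨dec, hdec, fun s' ε hε h => ?_⟩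
  have hterm : ∀ w w', noise n {z | dec (fun t => a * s w t + e * s' w' t + z t) ≠ w} ≤
      noise n {z | (s w, a • s w + (e • s' w' + z)) ∈ Bᶜ} +
      ∑ w₁ ∈ Finset.univ.erase w, noise n {z | (s w₁, a • s w + (e • s' w' + z)) ∈ B} := by
    intro w w'
    have hsub : {z : Fin n → ℝ | dec (fun t => a * s w t + e * s' w' t + z t) ≠ w} ⊆
        {z | (s w, a • s w + (e • s' w' + z)) ∈ Bᶜ} ∪
          ⋃ w₁ ∈ Finset.univ.erase w, {z | (s w₁, a • s w + (e • s' w' + z)) ∈ B} := by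
      intro z hz
      have hy : (fun t => a * s w t + e * s' w' t + z t) = a • s w + (e • s' w' + z) := by
        ext t; simp [add_assoc]
      rw [Set.mem_ofPred_eq, hy] at hz
      rcases herr w _ hz with h1 | ⟨w₁, hw₁, h1⟩
      · exact Or.inl h1
      · refine Or.inr (Set.mem_iUnion₂.2 ⟨w₁, by simp [hw₁], h1⟩)
    exact (measure_mono hsub).trans ((measure_union_le _ _).trans
      (add_le_add_right (measure_biUnion_finset_le _ _) _))
  have hle : (M : ℝ≥0∞)⁻¹ * ∑ w, (M : ℝ≥0∞)⁻¹ * ∑ w',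
      noise n {z | dec (fun t => a * s w t + e * s' w' t + z t) ≠ w} ≤ ENNReal.ofReal ε := by
    refine le_trans ?_ h
    unfold errorBound
    gcongr with w _ w' _
    exact hterm w w'
  have hr := ENNReal.toReal_mono ENNReal.ofReal_ne_top hle
  rw [ENNReal.toReal_ofReal hε] at hr
  refine le_trans (le_of_eq ?_) hr
  have hM0 : (M : ℝ≥0∞)⁻¹ ≠ ∞ := by simp [hM.ne']
  rw [ENNReal.toReal_mul, ENNReal.toReal_sum fun w _ => ENNReal.mul_ne_top hM0
    (ENNReal.sum_ne_top.2 fun w' _ => measure_ne_top _ _)]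
  simp only [ENNReal.toReal_mul, ENNReal.toReal_inv, ENNReal.toReal_natCast]
  congr 1
  refine Finset.sum_congr rfl fun w _ => ?_
  rw [ENNReal.toReal_sum fun w' _ => measure_ne_top _ _]
  rfl

end RandomCoding

/-! ### Achievability -/

section Achievability

/-- Below the mutual information there are codebooks for both users that meet the power constraint
and have small error bounds at both receivers, since each of the four requirements fails with
vanishing probability for random codebooks. -/
lemma exists_codebooks {a e P R T ε : ℝ} {q N V : ℝ≥0} (hN : (N : ℝ) = e ^ 2 * q + 1)
    (hV : (V : ℝ) = a ^ 2 * q + N) (hq : (q : ℝ) < P) (hR : 0 ≤ R) (hRT : R < T)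
    (hT : T < 1 / 2 * Real.log (V / N)) (hε : 0 < ε) :
    ∀ᶠ n : ℕ in atTop, ∃ M : ℕ, 0 < M ∧ Real.exp (n * R) ≤ M ∧ ∃ s s' : Fin M → Fin n → ℝ,
      (n : ℝ)⁻¹ * ∑ t, (M : ℝ)⁻¹ * ∑ w, s w t ^ 2 ≤ P ∧
      (n : ℝ)⁻¹ * ∑ t, (M : ℝ)⁻¹ * ∑ w, s' w t ^ 2 ≤ P ∧
      errorBound a e (testSet a N V T) s s' ≤ ENNReal.ofReal ε ∧
      errorBound a e (testSet a N V T) s' s ≤ ENNReal.ofReal ε := by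
  have hN0 : N ≠ 0 := by rw [← NNReal.coe_ne_zero, hN]; positivity
  obtain ⟨K₁, hK₁, hmiss⟩ := measure_compl_testSet_le a hN0 hV hT
  obtain ⟨K₂, hK₂, hpower⟩ := measure_power_excess_le hq
  have hlim : Tendsto (fun n : ℕ => (K₁ / n + 2 * Real.exp (-(n * (T - R)))) / ε +
      (K₁ / n + 2 * Real.exp (-(n * (T - R)))) / ε + K₂ / n + K₂ / n) atTop (nhds 0) := by
    have h1 : Tendsto (fun n : ℕ => K₁ / (n : ℝ)) atTop (nhds 0) :=
      tendsto_const_div_atTop_nhds_zero_nat K₁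
    have h2 : Tendsto (fun n : ℕ => K₂ / (n : ℝ)) atTop (nhds 0) :=
      tendsto_const_div_atTop_nhds_zero_nat K₂
    have h3 : Tendsto (fun n : ℕ => Real.exp (-(n * (T - R)))) atTop (nhds 0) :=
      Real.tendsto_exp_neg_atTop_nhds_zero.comp
        (tendsto_natCast_atTop_atTop.atTop_mul_const (sub_pos.2 hRT))
    have h4 := (h1.add (h3.const_mul 2)).div_const ε
    simpa using ((h4.add h4).add h2).add h2
  filter_upwards [hlim.eventually (gt_mem_nhds one_pos), eventually_gt_atTop 0] with n hlt hn
  have hn' : (0 : ℝ) < n := by exact_mod_cast hn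
  set M := ⌈Real.exp (n * R)⌉₊ with hM
  have hM0 : 0 < M := Nat.ceil_pos.2 (Real.exp_pos _)
  refine ⟨M, hM0, Nat.le_ceil _, ?_⟩
  have hMle : (M : ℝ) ≤ 2 * Real.exp (n * R) := by
    have h1 := (Nat.ceil_lt_add_one (Real.exp_pos (n * R)).le).le
    have h2 : 1 ≤ Real.exp (n * R) := Real.one_le_exp (by positivity)
    linarith
  set B := testSet (ι := Fin n) a N V T
  have hB : MeasurableSet B := measurableSet_testSet a N V T
  set μ := (codebookLaw M n q).prod (codebookLaw M n q)
  set A := K₁ / n + 2 * Real.exp (-(n * (T - R))) with hA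
  have hA0 : 0 ≤ A := by positivity
  have hmean : ∫⁻ p, errorBound a e B p.1 p.2 ∂μ ≤ ENNReal.ofReal A := by
    refine (lintegral_errorBound_le hN hV (hmiss n hn)).trans ?_
    rw [hA, ENNReal.ofReal_add (by positivity) (by positivity), ← ENNReal.ofReal_natCast,
      ← ENNReal.ofReal_mul (by positivity)]
    refine add_le_add le_rfl (ENNReal.ofReal_le_ofReal ?_)
    calc (M : ℝ) * Real.exp (-(n * T)) ≤ 2 * Real.exp (n * R) * Real.exp (-(n * T)) := by gcongr
      _ = 2 * Real.exp (-(n * (T - R))) := by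
        rw [mul_assoc, ← Real.exp_add]; ring_nf
  have hmeas := measurable_errorBound (M := M) hB a e
  have hmean' : ∫⁻ p, errorBound a e B p.2 p.1 ∂μ ≤ ENNReal.ofReal A := by
    have := lintegral_prod_swap (μ := codebookLaw M n q) (ν := codebookLaw M n q)
      (fun p => errorBound a e B p.1 p.2)
    exact this.trans_le hmean
  have hε0 : ENNReal.ofReal ε ≠ 0 := by simpa using hε
  have b1 : μ {p | ENNReal.ofReal ε ≤ errorBound a e B p.1 p.2} ≤ ENNReal.ofReal (A / ε) := by
    refine (meas_ge_le_lintegral_div hmeas.aemeasurable hε0 ENNReal.ofReal_ne_top).trans ?_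
    rw [ENNReal.ofReal_div_of_pos hε]
    gcongr
  have b2 : μ {p | ENNReal.ofReal ε ≤ errorBound a e B p.2 p.1} ≤ ENNReal.ofReal (A / ε) := by
    refine (meas_ge_le_lintegral_div (hmeas.comp measurable_swap).aemeasurable hε0
      ENNReal.ofReal_ne_top).trans ?_
    rw [ENNReal.ofReal_div_of_pos hε]
    gcongr
    exact hmean'
  set bad := {s : Fin M → Fin n → ℝ | ¬ (n : ℝ)⁻¹ * ∑ t, (M : ℝ)⁻¹ * ∑ w, s w t ^ 2 ≤ P}
  have hbad : MeasurableSet bad := by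
    have hm : Measurable fun s : Fin M → Fin n → ℝ =>
        (n : ℝ)⁻¹ * ∑ t, (M : ℝ)⁻¹ * ∑ w, s w t ^ 2 := by fun_prop
    exact (measurableSet_le hm measurable_const).compl
  have hb := hpower n M hn hM0
  have b3 : μ (Prod.fst ⁻¹' bad) ≤ ENNReal.ofReal (K₂ / n) := by
    rw [(measurePreserving_fst (μ := codebookLaw M n q)
      (ν := codebookLaw M n q)).measure_preimage hbad.nullMeasurableSet]
    exact hb
  have b4 : μ (Prod.snd ⁻¹' bad) ≤ ENNReal.ofReal (K₂ / n) := by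
    rw [(measurePreserving_snd (μ := codebookLaw M n q)
      (ν := codebookLaw M n q)).measure_preimage hbad.nullMeasurableSet]
    exact hb
  set U := (({p | ENNReal.ofReal ε ≤ errorBound a e B p.1 p.2} ∪
      {p | ENNReal.ofReal ε ≤ errorBound a e B p.2 p.1}) ∪ Prod.fst ⁻¹' bad) ∪
      Prod.snd ⁻¹' bad with hU
  have hunion : μ U < 1 := by
    calc _ ≤ ENNReal.ofReal (A / ε) + ENNReal.ofReal (A / ε) + ENNReal.ofReal (K₂ / n) +
          ENNReal.ofReal (K₂ / n) :=
        (measure_union_le _ _).trans (add_le_add ((measure_union_le _ _).trans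
          (add_le_add ((measure_union_le _ _).trans (add_le_add b1 b2)) b3)) b4)
      _ = ENNReal.ofReal (A / ε + A / ε + K₂ / n + K₂ / n) := by
        rw [ENNReal.ofReal_add (by positivity) (by positivity),
          ENNReal.ofReal_add (by positivity) (by positivity),
          ENNReal.ofReal_add (by positivity) (by positivity)]
      _ < 1 := by rw [ENNReal.ofReal_lt_one]; exact hlt
  have hne : U ≠ Set.univ := by
    intro h
    rw [h, measure_univ] at hunion
    exact lt_irrefl _ hunion
  obtain ⟨⟨s, s'⟩, hs⟩ := (Set.ne_univ_iff_exists_notMem _).1 hne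
  simp only [hU, Set.mem_union, Set.mem_preimage, Set.mem_ofPred_eq, not_or, not_le, bad] at hs
  exact ⟨s, s', not_lt.1 hs.1.2, not_lt.1 hs.2, hs.1.1.1.le, hs.1.1.2.le⟩

lemma posSemidef_inputCovariance {m n M : ℕ} (enc : Fin M → Fin n → EuclideanSpace ℝ (Fin m)) :
    (inputCovariance enc).PosSemidef := by
  refine Matrix.PosSemidef.smul (Matrix.posSemidef_sum _ fun t _ => Matrix.PosSemidef.smul
    (Matrix.posSemidef_sum _ fun w _ => ?_) (by positivity)) (by positivity)
  simpa using Matrix.posSemidef_vecMulVec_self_star (R := ℝ) (enc w t).ofLp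

/-- Every rate below the mutual information of beamforming with Gaussian symbols of power `q < P`
is achievable for both users at once. -/
lemma achievable_of_lt {m : ℕ} {d c b : EuclideanSpace ℝ (Fin m)} {h P R : ℝ} {q : ℝ≥0}
    (hb : ‖b‖ = 1) (hq : (q : ℝ) < P) (hR : 0 ≤ R)
    (hI : R < 1 / 2 * Real.log
      (1 + q * inner ℝ d b ^ 2 / (1 + h ^ 2 * (q * inner ℝ c b ^ 2)))) :
    Achievable d c h P R R := by
  set a := inner ℝ d b with ha
  set e := h * inner ℝ c b with he
  obtain ⟨N, hN⟩ : ∃ N : ℝ≥0, (N : ℝ) = e ^ 2 * q + 1 := ⟨⟨e ^ 2 * q + 1, by positivity⟩, rfl⟩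
  obtain ⟨V, hV⟩ : ∃ V : ℝ≥0, (V : ℝ) = a ^ 2 * q + N := ⟨⟨a ^ 2 * q + N, by positivity⟩, rfl⟩
  have hNpos : 0 < e ^ 2 * q + 1 := by positivity
  have hVN : (V : ℝ) / N = 1 + q * a ^ 2 / (1 + h ^ 2 * (q * inner ℝ c b ^ 2)) := by
    have : 1 + h ^ 2 * (q * inner ℝ c b ^ 2) = e ^ 2 * q + 1 := by rw [he]; ring
    rw [this, hV, hN]
    field_simp
    ring
  rw [← hVN] at hI
  obtain ⟨T, hRT, hT⟩ := exists_between hI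
  refine ⟨hR, hR, fun ε hε => ?_⟩
  filter_upwards [exists_codebooks hN hV hq hR hRT hT hε] with n hn
  obtain ⟨M, hM, hexp, s, s', hp, hp', he₁, he₂⟩ := hn
  obtain ⟨dec₁, hdec₁, herr₁⟩ := exists_decoder_errorBound hM (measurableSet_testSet a N V T) a e s
  obtain ⟨dec₂, hdec₂, herr₂⟩ := exists_decoder_errorBound hM (measurableSet_testSet a N V T) a e s'
  have hcov : ∀ r : Fin M → Fin n → ℝ, (n : ℝ)⁻¹ * ∑ t, (M : ℝ)⁻¹ * ∑ w, r w t ^ 2 ≤ P →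
      inputCovariance (fun w t => r w t • b) ∈ covarianceConstraint m P := by
    intro r hr
    refine ⟨posSemidef_inputCovariance _, ?_⟩
    rw [trace_inputCovariance]
    simpa [norm_smul, mul_pow, hb] using hr
  have hrec : ∀ x x' z : ℝ, received d c h (x • b) (x' • b) z = a * x + e * x' + z := by
    intro x x' z
    rw [received, inner_smul_right, inner_smul_right, ha, he]
    ring
  refine ⟨M, M, ⟨fun w t => s w t • b, fun w t => s' w t • b, dec₁, dec₂, hdec₁, hdec₂⟩, hexp, hexp,
    hcov s hp, hcov s' hp', ?_, ?_⟩
  · have := herr₁ s' ε hε.le he₁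
    simp only [Code.errorProb₁, hrec]
    simp_rw [← Finset.mul_sum] at this
    rwa [mul_inv, mul_assoc]
  · have := herr₂ s ε hε.le he₂
    simp only [Code.errorProb₂, hrec]
    simp_rw [← Finset.mul_sum] at this
    rwa [mul_inv, mul_assoc, Finset.sum_comm]

lemma achievable_zero {m : ℕ} (d c : EuclideanSpace ℝ (Fin m)) (h : ℝ) {P : ℝ} (hP : 0 ≤ P) :
    Achievable d c h P 0 0 := by
  refine ⟨le_rfl, le_rfl, fun ε hε => Eventually.of_forall fun n => ?_⟩
  have hcov : inputCovariance (m := m) (fun (_ : Fin 1) (_ : Fin n) => 0) ∈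
      covarianceConstraint m P := by
    refine ⟨posSemidef_inputCovariance _, ?_⟩
    rw [trace_inputCovariance]
    simpa using hP
  refine ⟨1, 1, ⟨fun _ _ => 0, fun _ _ => 0, fun _ => 0, fun _ => 0, measurable_const,
    measurable_const⟩, by simp, by simp, hcov, hcov, ?_, ?_⟩
  · simp only [Code.errorProb₁]
    simpa using hε.le
  · simp only [Code.errorProb₂]
    simpa using hε.le

/-- Every upper bound of the achievable sum rates is at least the sum rate of treating interference
as noise with the beam `b`. The symbol power `q < P` in `achievable_of_lt` is let tend to `P`. -/
lemma log_one_add_sinr_le {m : ℕ} {d c b : EuclideanSpace ℝ (Fin m)} {h P S : ℝ} (hP : 0 ≤ P)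
    (hb : ‖b‖ = 1)
    (hS : ∀ R₁ R₂, Achievable d c h P R₁ R₂ → R₁ + R₂ ≤ S) :
    Real.log (1 + P * inner ℝ d b ^ 2 / (1 + h ^ 2 * (P * inner ℝ c b ^ 2))) ≤ S := by
  have hS0 : 0 ≤ S := by simpa using hS 0 0 (achievable_zero d c h hP)
  by_contra! hlt
  rcases hP.eq_or_lt with rfl | hP'
  · simp at hlt
    linarith
  set f : ℝ → ℝ := fun q => Real.log (1 + q * inner ℝ d b ^ 2 / (1 + h ^ 2 * (q * inner ℝ c b ^ 2)))
  have hc : ContinuousAt f P := by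
    have h1 : 1 + h ^ 2 * (P * inner ℝ c b ^ 2) ≠ 0 := by positivity
    have h2 : 1 + P * inner ℝ d b ^ 2 / (1 + h ^ 2 * (P * inner ℝ c b ^ 2)) ≠ 0 := by positivity
    exact ContinuousAt.log (by fun_prop (disch := exact h1)) h2
  have h1 : ∀ᶠ q in nhdsWithin P (Set.Iio P), S < f q :=
    nhdsWithin_le_nhds (hc.eventually (lt_mem_nhds hlt))
  have h2 : ∀ᶠ q in nhdsWithin P (Set.Iio P), 0 < q := nhdsWithin_le_nhds (lt_mem_nhds hP')
  obtain ⟨q, hSq, hq0, hqP⟩ := (h1.and (h2.and self_mem_nhdsWithin)).exists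
  obtain ⟨R, hSR, hRq⟩ := exists_between hSq
  lift q to ℝ≥0 using hq0.le
  have hach : Achievable d c h P (R / 2) (R / 2) :=
    achievable_of_lt hb hqP (by linarith) (by
      have : R < Real.log _ := hRq
      linarith)
  have := hS _ _ hach
  linarith

end Achievability

end

end MISO

theorem theorem2 (θ P : ℝ) (hθ : θ ∈ Set.Ioo 0 (Real.pi / 2)) (hP : 0 ≤ P) :
    ∃ h₀ : ℝ, (MISO.IsThreshold θ P h₀ ∧ ∀ x, MISO.IsThreshold θ P x → x = h₀) ∧
      ∀ (m : ℕ) (d c : EuclideanSpace ℝ (Fin m)) (h : ℝ), ‖d‖ = 1 → ‖c‖ = 1 →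
        InnerProductGeometry.angle d c = θ → |h| < h₀ →
        ‖MISO.beam d c h P‖ = 1 ∧
        MISO.beamCovariance (MISO.beam d c h P) P ∈ MISO.covarianceConstraint m P ∧
        MISO.IsSumCapacity d c h P
          (Real.log (1 + P * Real.cos θ ^ 2 / (1 + h ^ 2 * P) + P * Real.sin θ ^ 2)) ∧
        MISO.tinSumRate d c h (MISO.beamCovariance (MISO.beam d c h P) P)
            (MISO.beamCovariance (MISO.beam d c h P) P) =
          ENNReal.ofReal
            (Real.log (1 + P * Real.cos θ ^ 2 / (1 + h ^ 2 * P) + P * Real.sin θ ^ 2)) := by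
  obtain ⟨h₀, huniq, hbelow⟩ := MISO.existsUnique_isThreshold θ P hθ hP
  refine ⟨h₀, huniq, fun m d c h hd hc hangle hh => ?_⟩
  have hsin : 0 < Real.sin θ :=
    Real.sin_pos_of_pos_of_lt_pi hθ.1 (by linarith [hθ.2, Real.pi_pos])
  have hcos : 0 < Real.cos θ := Real.cos_pos_of_mem_Ioo ⟨by linarith [hθ.1, Real.pi_pos], hθ.2⟩
  have hb : ‖MISO.beam d c h P‖ = 1 :=
    MISO.norm_beam (MISO.beamDirection_ne_zero hd hc hangle hsin hP)
  have hsinr := MISO.beam_sinr (h := h) hd hc hangle hsin hP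
  have hpsd := MISO.posSemidef_beamCovariance (MISO.beam d c h P) hP
  refine ⟨hb, MISO.beamCovariance_mem _ hb hP, ?_, ?_⟩
  · have hcond := hbelow |h| (abs_nonneg h) hh
    rw [sq_abs] at hcond
    obtain ⟨g, p, l, t, hg, ht, hpg, hform, hval⟩ :=
      MISO.exists_genie_parameters hcos hsin hP hcond
    have hconv : ∀ R₁ R₂, MISO.Achievable d c h P R₁ R₂ → R₁ + R₂ ≤
        Real.log (1 + P * Real.cos θ ^ 2 / (1 + h ^ 2 * P) + P * Real.sin θ ^ 2) := by
      intro R₁ R₂ hR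
      refine MISO.add_le_of_achievable (fun n M₁ M₂ C hn hM₁ hM₂ hC₁ hC₂ => ?_) hR
      have := MISO.log_card_add_log_card_le hn hM₁ hM₂ C hd hc hangle hsin hP hg ht hpg hform hC₁ hC₂
      rwa [hval, mul_div_cancel_left₀ _ (by positivity)] at this
    refine ⟨?_, fun S hS => ?_⟩
    · rintro r ⟨R₁, R₂, hR, rfl⟩
      exact hconv R₁ R₂ hR
    · have := MISO.log_one_add_sinr_le hP hb (d := d) (c := c) (h := h) (S := S)
        fun R₁ R₂ hR => hS ⟨R₁, R₂, hR, rfl⟩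
      rwa [hsinr, ← add_assoc] at this
  · rw [MISO.tinSumRate, MISO.gaussianInputRate_eq d c h hpsd hpsd,
      MISO.dotProduct_beamCovariance, MISO.dotProduct_beamCovariance, hsinr, ← add_assoc]
    have hlog : 0 ≤ Real.log
        (1 + P * Real.cos θ ^ 2 / (1 + h ^ 2 * P) + P * Real.sin θ ^ 2) := by
      refine Real.log_nonneg ?_
      have h1 : 0 ≤ P * Real.cos θ ^ 2 / (1 + h ^ 2 * P) := by positivity
      have h2 : 0 ≤ P * Real.sin θ ^ 2 := by positivity
      linarith
    rw [← ENNReal.ofReal_add (by positivity) (by positivity)]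
    congr 1
    ring
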